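/- **Conventions.** Units are $8\pi G=c=1$, and all statements are local, i.e. in coordinate charts. For $k\in\{1,0,-1\}$ let $\Sigma(y,k)=\sin y,\;y,\;\sinh y$ and $F(y,k)=-\cos y,\;y^2/2,\;\cosh y$ respectively. A *$G_4$ on $S_3$ LRS spacetime* over an open interval $I$ is the metric $$ds^2=-dt^2+a(t)^2\big(dz+n(F(r,k)+k)\,d\varphi\big)^2+b(t)^2\big[(dr-\epsilon r\,dz)^2+\Sigma(r,k)^2d\varphi^2\big],\qquad t\in I,\ r>0\ (r<\pi\text{ if }k=1),$$ with $\epsilon,n\in\{0,1\}$, $\epsilon n=\epsilon k=0$, and $a,b>0$ of class $C^2$. It is *non-static* on a time range $J$ if $a'$ and $b'$ do not both vanish identically on $J$. An *orthogonally transitive (OT) cylindrically symmetric static spacetime* is the metric $$ds^2=-A^2dT^2+B^2d\rho^2+C^2d\tilde\varphi^2+D^2d\tilde z^2+2E\,d\tilde\varphi\,d\tilde z,$$ where $A,B,C>0$, $D$ and $E$ are $C^2$ functions of $\rho$ on an open interval and $C^2D^2-E^2>0$; its axial Killing vector is $\partial_{\tilde\varphi}$. Two spacetimes are *matched* across a connected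 hypersurface $\sigma$ if there are $C^3$ rank-3 embeddings $\Phi^\pm$ of $\sigma$ into them whose first fundamental forms coincide, and transversal vector fields (riggings) $\ell^\pm$ along $\sigma$, with equal norms and equal scalar products with the tangent vectors $e^\pm_a=d\Phi^\pm(\partial_{\xi^a})$, such that the generalised second fundamental forms $H^\pm_{ab}=-\ell^\pm_\nu e^{\pm\mu}_a\nabla^\pm_\mu e^{\pm\nu}_b$ coincide. The matching *preserves the cylindrical symmetry* if there are vector fields $\gamma_1,\gamma_2$ on $\sigma$ mapped to $\partial_\varphi,\partial_z$ on the LRS side and to $\partial_{\tilde\varphi}$ and $a_0\partial_{\tilde\varphi}+b_0\partial_{\tilde z}+c_0\partial_T$ (with constants $a_0,b_0,c_0$) on the static side. A spacetime is a *perfect fluid* with density $\rho$ and pressure $p$ if its Einstein tensor is $G_{\mu\nu}=(\rho+p)u_\mu u_\nu+p\,g_{\mu\nu}$ with $u^\mu u_\mu=-1$ and $\rho+p\neq0$; then the *dominant energy condition* is $|p|\le\rho$. **Theorem.** (i) Suppose that a perfect-fluid $G_4$ on $S_3$ LRS spacetime satisfying the dominant energy condition is matched, across a nowhere spacelike hypersurface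 $\sigma$ and preserving the cylindrical symmetry, to an OT cylindrically symmetric static spacetime, and let $J\subseteq I$ be the set of values of $t$ taken on $\sigma$. If the LRS spacetime is non-static on $J$, then on the part $t\in J$ its metric is, for some constant $\alpha>0$ and after replacing $t$ by $\pm(t-t_0)$ and $z$ by $\beta z$ for suitable constants $t_0$ and $\beta>0$, $$ds^2=-dt^2+dz^2+(\alpha t-kt^2)\left[dr^2+\Sigma(r,k)^2d\varphi^2\right],\qquad t>0,\ \alpha-kt>0, \tag{$*$}$$ and the fluid is stiff there: $$\rho=p=\frac{\alpha^2}{4t^2(\alpha-kt)^2}.$$ (ii) Conversely, for all $k\in\{1,0,-1\}$ and $\alpha>0$ the metric $(*)$, on its whole time range $t>0$, $\alpha-kt>0$, is a $G_4$ on $S_3$ LRS perfect fluid with velocity $\partial_t$ and with this $\rho=p$, it satisfies the dominant energy condition, and it can be matched, across some nowhere spacelike hypersurface and preserving the cylindrical symmetry, to some OT cylindrically symmetric static spacetime, the metric being non-static on the time range of that hypersurface. -/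

import Mathlib

/-! ### Calculus and curvature in a coordinate chart

Points of a chart of the four-dimensional spacetime are elements of `Fin 4 → ℝ`; points of a
coordinate patch of the matching hypersurface are elements of `Fin 3 → ℝ`. -/

/-- The partial derivative of `f` in the `i`-th coordinate at `x`. -/
noncomputable def partialD {m : ℕ} (i : Fin m) (f : (Fin m → ℝ) → ℝ) (x : Fin m → ℝ) : ℝ :=
  deriv (fun s : ℝ => f (Function.update x i s)) (x i)

/-- A field of symmetric `4 × 4` matrices `g_{μν}(x)`: the covariant components of a metric. -/
abbrev MetricField := (Fin 4 → ℝ) → Matrix (Fin 4) (Fin 4) ℝ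

/-- The scalar product `g_{μν} v^μ w^ν` at the point `x`. -/
noncomputable def metricAt (g : MetricField) (x v w : Fin 4 → ℝ) : ℝ :=
  ∑ μ, ∑ ν, g x μ ν * v μ * w ν

/-- Lowering an index: `u_μ = g_{μν} u^ν`. -/
noncomputable def lowerIndex (g : MetricField) (x u : Fin 4 → ℝ) (μ : Fin 4) : ℝ :=
  ∑ ν, g x μ ν * u ν

/-- The Christoffel symbols `Γ^l_{μν}` of the Levi-Civita connection. -/
noncomputable def christoffel (g : MetricField) (l μ ν : Fin 4) (x : Fin 4 → ℝ) : ℝ :=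
  (1 / 2) * ∑ κ, (g x)⁻¹ l κ *
    (partialD μ (fun y => g y κ ν) x + partialD ν (fun y => g y κ μ) x
      - partialD κ (fun y => g y μ ν) x)

/-- The Ricci tensor `R_{μν} = ∂_l Γ^l_{μν} - ∂_ν Γ^l_{μl} + Γ^l_{lκ} Γ^κ_{μν} - Γ^l_{νκ} Γ^κ_{μl}`. -/
noncomputable def ricci (g : MetricField) (μ ν : Fin 4) (x : Fin 4 → ℝ) : ℝ :=
  ∑ l, (partialD l (christoffel g l μ ν) x - partialD ν (christoffel g l μ l) x
    + ∑ κ, (christoffel g l l κ x * christoffel g κ μ ν x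
      - christoffel g l ν κ x * christoffel g κ μ l x))

/-- The scalar curvature `R = g^{μν} R_{μν}`. -/
noncomputable def scalarCurvature (g : MetricField) (x : Fin 4 → ℝ) : ℝ :=
  ∑ μ, ∑ ν, (g x)⁻¹ μ ν * ricci g μ ν x

/-- The Einstein tensor `G_{μν} = R_{μν} - (R / 2) g_{μν}`. -/
noncomputable def einsteinTensor (g : MetricField) (μ ν : Fin 4) (x : Fin 4 → ℝ) : ℝ :=
  ricci g μ ν x - scalarCurvature g x / 2 * g x μ ν

/-- The pull-back `(ψ^* g)_{μν} = g_{κl} ∂_μ ψ^κ ∂_ν ψ^l` of a metric by a coordinate map. -/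
noncomputable def pullbackMetric (ψ : (Fin 4 → ℝ) → (Fin 4 → ℝ)) (g : MetricField) : MetricField :=
  fun x => Matrix.of fun μ ν =>
    ∑ κ, ∑ l, g (ψ x) κ l * partialD μ (fun y => ψ y κ) x * partialD ν (fun y => ψ y l) x

/-- At `x` the Einstein tensor is that of a perfect fluid with energy density `ρ`, pressure `p`
and unit timelike velocity `u` (units with `8πG = c = 1`):
`G_{μν} = (ρ + p) u_μ u_ν + p g_{μν}`, with the Einstein tensor not proportional to the metric,
i.e. `ρ + p ≠ 0` (Segre type `{1,(111)}`, non-degenerate). -/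
def IsPerfectFluidAt (g : MetricField) (x : Fin 4 → ℝ) (ρ p : ℝ) (u : Fin 4 → ℝ) : Prop :=
  metricAt g x u u = -1 ∧ ρ + p ≠ 0 ∧
    ∀ μ ν, einsteinTensor g μ ν x =
      (ρ + p) * lowerIndex g x u μ * lowerIndex g x u ν + p * g x μ ν

/-- The dominant energy condition for a perfect fluid with energy density `ρ` and pressure `p`. -/
def DominantEnergy (ρ p : ℝ) : Prop := |p| ≤ ρ

/-! ### Locally rotationally symmetric spacetimes with a `G₄` on `S₃` -/

/-- `Σ(y,k)`: `sin y`, `y`, `sinh y` for `k = 1, 0, -1`. -/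
noncomputable def sigmaFn (k : ℤ) (y : ℝ) : ℝ :=
  if k = 1 then Real.sin y else if k = 0 then y else Real.sinh y

/-- `F(y,k)`: `-cos y`, `y² / 2`, `cosh y` for `k = 1, 0, -1`. -/
noncomputable def fFn (k : ℤ) (y : ℝ) : ℝ :=
  if k = 1 then -Real.cos y else if k = 0 then y ^ 2 / 2 else Real.cosh y

/-- The data of a `G₄` on `S₃` LRS spacetime over the open time interval `I`, in the coordinates
`(t, r, φ, z)` adapted to the axial Killing vector `∂_φ` and to the Killing vector `∂_z`:
`ds² = -dt² + a(t)² (dz + n (F(r,k) + k) dφ)² + b(t)² ((dr - ε r dz)² + Σ(r,k)² dφ²)`. -/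
structure LRSSpacetime where
  /-- the parameter `ε` -/
  ε : ℝ
  /-- the parameter `n` -/
  n : ℝ
  /-- the parameter `k` -/
  k : ℤ
  ε_eq : ε = 0 ∨ ε = 1
  n_eq : n = 0 ∨ n = 1
  k_eq : k = 1 ∨ k = 0 ∨ k = -1
  ε_mul_n : ε * n = 0
  ε_mul_k : ε * (k : ℝ) = 0
  /-- the range of the time coordinate -/
  I : Set ℝ
  isOpen_I : IsOpen I
  isConnected_I : IsConnected I
  /-- the metric function `a` -/
  a : ℝ → ℝ
  /-- the metric function `b` -/
  b : ℝ → ℝ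
  contDiffOn_a : ContDiffOn ℝ 2 a I
  contDiffOn_b : ContDiffOn ℝ 2 b I
  a_pos : ∀ t ∈ I, 0 < a t
  b_pos : ∀ t ∈ I, 0 < b t

namespace LRSSpacetime

/-- The coordinate domain: `t ∈ I`, `r > 0`, and `r < π` if `k = 1` (off the axis, where
`Σ(r,k) > 0`); `φ` and `z` are unrestricted, the treatment being local. -/
def domain (M : LRSSpacetime) : Set (Fin 4 → ℝ) :=
  {x | x 0 ∈ M.I ∧ 0 < x 1 ∧ (M.k = 1 → x 1 < Real.pi)}

/-- The metric components in the coordinates `(t, r, φ, z)`. -/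
noncomputable def metric (M : LRSSpacetime) : MetricField := fun x =>
  let A := M.a (x 0) ^ 2
  let B := M.b (x 0) ^ 2
  let S := sigmaFn M.k (x 1)
  let P := M.n * (fFn M.k (x 1) + (M.k : ℝ))
  !![-1, 0, 0, 0;
     0, B, 0, -(M.ε * x 1 * B);
     0, 0, A * P ^ 2 + B * S ^ 2, A * P;
     0, -(M.ε * x 1 * B), A * P, A + B * (M.ε * x 1) ^ 2]

/-- The components above are those of the line element. -/
theorem metricAt_self (M : LRSSpacetime) (x v : Fin 4 → ℝ) :
    metricAt M.metric x v v =
      -(v 0) ^ 2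
        + M.a (x 0) ^ 2 * (v 3 + M.n * (fFn M.k (x 1) + (M.k : ℝ)) * v 2) ^ 2
        + M.b (x 0) ^ 2 *
            ((v 1 - M.ε * x 1 * v 3) ^ 2 + sigmaFn M.k (x 1) ^ 2 * v 2 ^ 2) := by
  simp [metricAt, metric, Fin.sum_univ_four]
  ring

/-- The metric evolves somewhere in the time range `J`: `a` and `b` are not both stationary
throughout `J`. -/
def NonStaticOn (M : LRSSpacetime) (J : Set ℝ) : Prop :=
  ∃ t ∈ J, deriv M.a t ≠ 0 ∨ deriv M.b t ≠ 0

end LRSSpacetime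

/-! ### Static cylindrically symmetric spacetimes with an orthogonally transitive `G₂` -/

/-- The data of a static, orthogonally transitive cylindrically symmetric spacetime, in coordinates
`(T, ρ, φ, z)` adapted to the static Killing vector `∂_T`, the axial Killing vector `∂_φ` and `∂_z`:
`ds² = -A² dT² + B² dρ² + C² dφ² + D² dz² + 2 E dφ dz`, all functions of `ρ` only. -/
structure StaticCylindrical where
  /-- the range of the coordinate `ρ` -/
  K : Set ℝ
  isOpen_K : IsOpen K
  isConnected_K : IsConnected K
  /-- the metric function `A` -/
  A : ℝ → ℝ
  /-- the metric function `B` -/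
  B : ℝ → ℝ
  /-- the metric function `C` -/
  C : ℝ → ℝ
  /-- the metric function `D` -/
  D : ℝ → ℝ
  /-- the metric function `E` -/
  E : ℝ → ℝ
  contDiffOn_A : ContDiffOn ℝ 2 A K
  contDiffOn_B : ContDiffOn ℝ 2 B K
  contDiffOn_C : ContDiffOn ℝ 2 C K
  contDiffOn_D : ContDiffOn ℝ 2 D K
  contDiffOn_E : ContDiffOn ℝ 2 E K
  A_pos : ∀ r ∈ K, 0 < A r
  B_pos : ∀ r ∈ K, 0 < B r
  C_pos : ∀ r ∈ K, 0 < C r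
  /-- the orbits of `∂_φ`, `∂_z` are spacelike surfaces -/
  orbits_spacelike : ∀ r ∈ K, 0 < C r ^ 2 * D r ^ 2 - E r ^ 2

namespace StaticCylindrical

/-- The coordinate domain `ρ ∈ K`. -/
def domain (N : StaticCylindrical) : Set (Fin 4 → ℝ) := {x | x 1 ∈ N.K}

/-- The metric components in the coordinates `(T, ρ, φ, z)`. -/
noncomputable def metric (N : StaticCylindrical) : MetricField := fun x =>
  !![-(N.A (x 1) ^ 2), 0, 0, 0;
     0, N.B (x 1) ^ 2, 0, 0;
     0, 0, N.C (x 1) ^ 2, N.E (x 1);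
     0, 0, N.E (x 1), N.D (x 1) ^ 2]

end StaticCylindrical

/-! ### Matching of two spacetimes across a hypersurface -/

/-- The tangent vector `e_a = dΦ(∂/∂ξ^a)`, with components `∂Φ^μ/∂ξ^a`. -/
noncomputable def tangentVec (Φ : (Fin 3 → ℝ) → (Fin 4 → ℝ)) (a : Fin 3) (ξ : Fin 3 → ℝ) :
    Fin 4 → ℝ :=
  fun μ => partialD a (fun η => Φ η μ) ξ

/-- The push-forward `dΦ(γ) = γ^a e_a` of a vector field `γ` on the hypersurface. -/
noncomputable def pushForward (Φ : (Fin 3 → ℝ) → (Fin 4 → ℝ)) (γ : (Fin 3 → ℝ) → (Fin 3 → ℝ))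
    (ξ : Fin 3 → ℝ) : Fin 4 → ℝ :=
  ∑ a, γ ξ a • tangentVec Φ a ξ

/-- The generalised second fundamental form `H_{ab} = -ℓ_ν e_a^μ ∇_μ e_b^ν` relative to the
rigging `ℓ`, where `e_a^μ ∇_μ e_b^ν = ∂e_b^ν/∂ξ^a + Γ^ν_{μκ} e_a^μ e_b^κ`. -/
noncomputable def secondForm (g : MetricField) (Φ : (Fin 3 → ℝ) → (Fin 4 → ℝ))
    (l : (Fin 3 → ℝ) → (Fin 4 → ℝ)) (a b : Fin 3) (ξ : Fin 3 → ℝ) : ℝ :=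
  -metricAt g (Φ ξ) (l ξ) (fun ν =>
    partialD a (fun η => tangentVec Φ b η ν) ξ
      + ∑ μ, ∑ κ, christoffel g ν μ κ (Φ ξ) * tangentVec Φ a ξ μ * tangentVec Φ b ξ κ)

/-- A matching of two spacetimes `(Up, gp)` and `(Um, gm)`, given in charts, across a connected
hypersurface: a patch `S` with coordinates `ξ^a`, two `C³` embeddings of rank 3, equality of the
first fundamental forms, and riggings (transversal vector fields along the hypersurface that are
identified with each other) relative to which the generalised second fundamental forms agree.
The riggings determine the sides that are kept: `lp` points into the part of `Up`, and `lm` out of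
the part of `Um`, that are glued together; both relative orientations are allowed. -/
structure Matching (gp : MetricField) (Up : Set (Fin 4 → ℝ))
    (gm : MetricField) (Um : Set (Fin 4 → ℝ)) where
  /-- the coordinate patch of the hypersurface -/
  S : Set (Fin 3 → ℝ)
  isOpen_S : IsOpen S
  isConnected_S : IsConnected S
  /-- the embedding in the first spacetime -/
  Φp : (Fin 3 → ℝ) → (Fin 4 → ℝ)
  /-- the embedding in the second spacetime -/
  Φm : (Fin 3 → ℝ) → (Fin 4 → ℝ)
  mapsTo_p : Set.MapsTo Φp S Up
  mapsTo_m : Set.MapsTo Φm S Um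
  contDiffOn_p : ContDiffOn ℝ 3 Φp S
  contDiffOn_m : ContDiffOn ℝ 3 Φm S
  isEmbedding_p : Topology.IsEmbedding (S.domRestrict Φp)
  isEmbedding_m : Topology.IsEmbedding (S.domRestrict Φm)
  rank_p : ∀ ξ ∈ S, LinearIndependent ℝ (fun a => tangentVec Φp a ξ)
  rank_m : ∀ ξ ∈ S, LinearIndependent ℝ (fun a => tangentVec Φm a ξ)
  /-- the preliminary junction conditions -/
  first_form : ∀ ξ ∈ S, ∀ a b,
    metricAt gp (Φp ξ) (tangentVec Φp a ξ) (tangentVec Φp b ξ) =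
      metricAt gm (Φm ξ) (tangentVec Φm a ξ) (tangentVec Φm b ξ)
  /-- the rigging in the first spacetime -/
  lp : (Fin 3 → ℝ) → (Fin 4 → ℝ)
  /-- the rigging in the second spacetime -/
  lm : (Fin 3 → ℝ) → (Fin 4 → ℝ)
  continuousOn_lp : ContinuousOn lp S
  continuousOn_lm : ContinuousOn lm S
  transversal_p : ∀ ξ ∈ S, lp ξ ∉ Submodule.span ℝ (Set.range fun a => tangentVec Φp a ξ)
  transversal_m : ∀ ξ ∈ S, lm ξ ∉ Submodule.span ℝ (Set.range fun a => tangentVec Φm a ξ)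
  rigging_norm : ∀ ξ ∈ S,
    metricAt gp (Φp ξ) (lp ξ) (lp ξ) = metricAt gm (Φm ξ) (lm ξ) (lm ξ)
  rigging_tangent : ∀ ξ ∈ S, ∀ a,
    metricAt gp (Φp ξ) (lp ξ) (tangentVec Φp a ξ) = metricAt gm (Φm ξ) (lm ξ) (tangentVec Φm a ξ)
  /-- the remaining junction conditions -/
  second_form : ∀ ξ ∈ S, ∀ a b, secondForm gp Φp lp a b ξ = secondForm gm Φm lm a b ξ

namespace Matching

variable {gp gm : MetricField} {Up Um : Set (Fin 4 → ℝ)}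

/-- The hypersurface is nowhere spacelike (it is timelike or null at each point): each of its
tangent spaces contains a nonzero causal vector. -/
def NonSpacelike (σ : Matching gp Up gm Um) : Prop :=
  ∀ ξ ∈ σ.S, ∃ v ∈ Submodule.span ℝ (Set.range fun a => tangentVec σ.Φp a ξ),
    v ≠ 0 ∧ metricAt gp (σ.Φp ξ) v v ≤ 0

/-- The values taken on the hypersurface by the coordinate `x⁰` of the first spacetime. -/
def timeRange (σ : Matching gp Up gm Um) : Set ℝ := (fun ξ => σ.Φp ξ 0) '' σ.S

end Matching

/-- The matching preserves the cylindrical symmetry: there are vector fields `γ₁`, `γ₂` on the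
hypersurface that are mapped to the generators `∂_φ` (axial), `∂_z` of the Abelian `G₂` of the LRS
spacetime on one side, and, on the other side, to the axial Killing vector and to some Killing vector
`a ∂_φ + b ∂_z + c ∂_T` of the `G₃` of the static spacetime. That the two images on the static side
again generate a two-parameter group with spacelike orbits (in particular `b ≠ 0`) follows from the
junction conditions. -/
def PreservesCylindricalSymmetry (M : LRSSpacetime) (N : StaticCylindrical)
    (σ : Matching M.metric M.domain N.metric N.domain) : Prop :=
  ∃ γ₁ γ₂ : (Fin 3 → ℝ) → (Fin 3 → ℝ), ContDiffOn ℝ 2 γ₁ σ.S ∧ ContDiffOn ℝ 2 γ₂ σ.S ∧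
    ∃ a b c : ℝ, ∀ ξ ∈ σ.S,
      pushForward σ.Φp γ₁ ξ = Pi.single 2 1 ∧
      pushForward σ.Φm γ₁ ξ = Pi.single 2 1 ∧
      pushForward σ.Φp γ₂ ξ = Pi.single 3 1 ∧
      pushForward σ.Φm γ₂ ξ = a • Pi.single 2 1 + b • Pi.single 3 1 + c • Pi.single 0 1

/-! ### The stiff fluid family -/

/-- The metric `ds² = -dt² + dz² + (α t - k t²) (dr² + Σ(r,k)² dφ²)` in the coordinates
`(t, r, φ, z)`. -/
noncomputable def stiffMetric (k : ℤ) (α : ℝ) : MetricField := fun x =>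
  let W := α * x 0 - (k : ℝ) * x 0 ^ 2
  Matrix.diagonal ![-1, W, W * sigmaFn k (x 1) ^ 2, 1]

/-- The time range `t > 0`, `α - k t > 0` of that metric. -/
def stiffTime (k : ℤ) (α : ℝ) : Set ℝ := {t | 0 < t ∧ 0 < α - (k : ℝ) * t}

/-- The function `α² / (4 t² (α - k t)²)`. -/
noncomputable def stiffDensity (k : ℤ) (α t : ℝ) : ℝ :=
  α ^ 2 / (4 * t ^ 2 * (α - (k : ℝ) * t) ^ 2)

/-- The change of coordinates `t ↦ τ (t - t₀)`, `z ↦ β z` (a translation, and for `τ = -1` a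
reversal, of time, and a change of the unit of `z`). -/
def normalizeCoord (τ t₀ β : ℝ) (x : Fin 4 → ℝ) : Fin 4 → ℝ :=
  ![τ * (x 0 - t₀), x 1, x 2, β * x 3]

/-!
Across a matching, the tangent spaces on the two sides are identified by `e_a ↦ e_a`, `ℓ ↦ ℓ`, an
isometry.  If `Z_i` are symmetry generators tangent to the hypersurface, the identification also
preserves the differentials of the scalar products `Z_i · Z_j`: tangentially by the equality of the
first fundamental forms, and along the rigging because
`2 ℓ · ∇_{Z_i} Z_j = -ℓ(Z_i · Z_j)` is read off from the second fundamental form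
(`Matching.exists_corresponding_vector`).  The static Killing vector `∂_T` annihilates all the
`Z_i · Z_j` on its side, so that it corresponds to a timelike vector `v` on the LRS side with
`v(g_φφ) = v(g_φz) = v(g_zz) = 0`.  Being timelike, `v` has a nonzero component along `∂_t`, and the
explicit form of the metric gives `a' = 0` for every `ε`, `n`, and also `b' = 0` for `n = 1`
(`deriv_eq_zero_of_preservesCylindricalSymmetry`).  As the hypersurface is nowhere spacelike, `t`
takes an open interval of values on it; there `a` is constant, and `n = 0` since the metric is not
static.

For a perfect fluid `R_{μν} = (ρ + p) u_μ u_ν + (ρ - p) / 2 g_{μν}`, which under the dominant energy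
condition is nonnegative on spacelike vectors.  With `a` constant, the Ricci tensor takes the value
`-2 ε²` on `∂_z + ε r ∂_r`.  Hence `ε = 0` (`LRSSpacetime.epsilon_eq_zero`), both terms vanish on
`∂_z`, which makes the fluid stiff, and the remaining equations say that `W = b²` satisfies
`W'' = -2 k` with `4 k W + W'² = 4 W² ρ > 0` (`LRSSpacetime.stiff_of_perfectFluid`).  Its solutions
are `W = α s - k s²` with `s = ± (t - t₀)` (`exists_eq_quadratic`).

Conversely, let `W = α t - k t²`.  The comoving hypersurface `r = r₀` with `Σ(r₀,k) = 1 / 2`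
projects to a timelike geodesic of the quotient by `∂_φ`, `∂_z`.  The static metric
`-f dT² + (c² / f - 1) dρ² + (W(ρ) / 4) dφ² + dz²` with `f = 1 - α² / (16 W)` and `c = Σ'(r₀,k)` has
a geodesic with velocity `dT/dt = c / f`, `dρ/dt = 1` along which the length of `∂_φ` and its normal
derivative are those of the fluid; both sides match there with normal riggings (`stiffMatching`).
-/

/-! ### Partial derivatives -/

theorem hasDerivAt_comp_update {m : ℕ} {f : (Fin m → ℝ) → ℝ} {x : Fin m → ℝ}
    (hf : DifferentiableAt ℝ f x) (i : Fin m) :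
    HasDerivAt (fun s : ℝ => f (Function.update x i s)) (fderiv ℝ f x (Pi.single i 1)) (x i) := by
  have h := hasDerivAt_update x i (x i)
  exact hf.hasFDerivAt.comp_hasDerivAt_of_eq (x i) h (by simp)

theorem partialD_eq_fderiv {m : ℕ} {f : (Fin m → ℝ) → ℝ} {x : Fin m → ℝ}
    (hf : DifferentiableAt ℝ f x) (i : Fin m) :
    partialD i f x = fderiv ℝ f x (Pi.single i 1) :=
  (hasDerivAt_comp_update hf i).deriv

theorem partialD_congr {m : ℕ} {f g : (Fin m → ℝ) → ℝ} {x : Fin m → ℝ}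
    (h : f =ᶠ[nhds x] g) (i : Fin m) : partialD i f x = partialD i g x := by
  refine Filter.EventuallyEq.deriv_eq ?_
  have hc : ContinuousAt (fun s : ℝ => Function.update x i s) (x i) :=
    (hasDerivAt_update x i (x i)).continuousAt
  have ht : Filter.Tendsto (fun s : ℝ => Function.update x i s) (nhds (x i)) (nhds x) := by
    have := hc.tendsto
    rwa [Function.update_eq_self] at this
  exact ht.eventually h

theorem fderiv_apply_eq_sum_partialD {m : ℕ} {f : (Fin m → ℝ) → ℝ} {x : Fin m → ℝ}
    (hf : DifferentiableAt ℝ f x) (v : Fin m → ℝ) :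
    fderiv ℝ f x v = ∑ i, v i * partialD i f x := by
  conv_lhs => rw [pi_eq_sum_univ' v]
  simp [partialD_eq_fderiv hf]

theorem partialD_comp {m n : ℕ} {f : (Fin m → ℝ) → ℝ} {Φ : (Fin n → ℝ) → (Fin m → ℝ)}
    {ξ : Fin n → ℝ} (hf : DifferentiableAt ℝ f (Φ ξ)) (hΦ : DifferentiableAt ℝ Φ ξ) (a : Fin n) :
    partialD a (fun η => f (Φ η)) ξ =
      ∑ μ, partialD a (fun η => Φ η μ) ξ * partialD μ f (Φ ξ) := by
  have hc : DifferentiableAt ℝ (fun η => f (Φ η)) ξ := hf.comp ξ hΦ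
  rw [partialD_eq_fderiv hc, show (fun η => f (Φ η)) = f ∘ Φ from rfl, fderiv_comp ξ hf hΦ,
    ContinuousLinearMap.comp_apply, fderiv_apply_eq_sum_partialD hf]
  refine Finset.sum_congr rfl fun μ _ => ?_
  rw [partialD_eq_fderiv (differentiableAt_pi.1 hΦ μ), fderiv_apply hΦ]
  rfl

/-! ### Bilinear algebra of the metric -/

theorem metricAt_sum_sum {ι κ : Type*} [Fintype ι] [Fintype κ] (g : MetricField) (x : Fin 4 → ℝ)
    (c : ι → ℝ) (d : κ → ℝ) (v : ι → Fin 4 → ℝ) (w : κ → Fin 4 → ℝ) :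
    metricAt g x (∑ a, c a • v a) (∑ b, d b • w b) =
      ∑ a, ∑ b, c a * d b * metricAt g x (v a) (w b) := by
  have h : ∀ v w, metricAt g x v w = Matrix.toBilin' (g x) v w := fun v w => by
    rw [Matrix.toBilin'_apply]
    exact Finset.sum_congr rfl fun i _ => Finset.sum_congr rfl fun j _ => by ring
  simp only [h, map_sum, map_smul, LinearMap.sum_apply, LinearMap.smul_apply, smul_eq_mul,
    Finset.mul_sum]
  rw [Finset.sum_comm]
  exact Finset.sum_congr rfl fun i _ => Finset.sum_congr rfl fun j _ => by ring

theorem metricAt_add_left (g : MetricField) (x v v' w : Fin 4 → ℝ) :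
    metricAt g x (v + v') w = metricAt g x v w + metricAt g x v' w := by
  simp only [metricAt, ← Finset.sum_add_distrib, Pi.add_apply]
  exact Finset.sum_congr rfl fun i _ => Finset.sum_congr rfl fun j _ => by ring

theorem metricAt_add_right (g : MetricField) (x v w w' : Fin 4 → ℝ) :
    metricAt g x v (w + w') = metricAt g x v w + metricAt g x v w' := by
  simp only [metricAt, ← Finset.sum_add_distrib, Pi.add_apply]
  exact Finset.sum_congr rfl fun i _ => Finset.sum_congr rfl fun j _ => by ring

theorem metricAt_smul_left (g : MetricField) (x : Fin 4 → ℝ) (c : ℝ) (v w : Fin 4 → ℝ) :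
    metricAt g x (c • v) w = c * metricAt g x v w := by
  simp only [metricAt, Finset.mul_sum, Pi.smul_apply, smul_eq_mul]
  exact Finset.sum_congr rfl fun i _ => Finset.sum_congr rfl fun j _ => by ring

theorem metricAt_smul_right (g : MetricField) (x : Fin 4 → ℝ) (c : ℝ) (v w : Fin 4 → ℝ) :
    metricAt g x v (c • w) = c * metricAt g x v w := by
  simp only [metricAt, Finset.mul_sum, Pi.smul_apply, smul_eq_mul]
  exact Finset.sum_congr rfl fun i _ => Finset.sum_congr rfl fun j _ => by ring

theorem metricAt_comm {g : MetricField} {x : Fin 4 → ℝ} (hs : (g x).IsSymm) (v w : Fin 4 → ℝ) :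
    metricAt g x v w = metricAt g x w v := by
  unfold metricAt
  rw [Finset.sum_comm]
  refine Finset.sum_congr rfl fun i _ => Finset.sum_congr rfl fun j _ => ?_
  rw [hs.apply]
  ring

theorem metricAt_sum_right {κ : Type*} [Fintype κ] (g : MetricField) (x v : Fin 4 → ℝ)
    (d : κ → ℝ) (w : κ → Fin 4 → ℝ) :
    metricAt g x v (∑ b, d b • w b) = ∑ b, d b * metricAt g x v (w b) := by
  have := metricAt_sum_sum g x (fun _ : Unit => (1 : ℝ)) d (fun _ => v) w
  simpa using this

/-- Lowering the upper index of the Christoffel symbols removes the inverse metric. -/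
theorem metricAt_christoffel {g : MetricField} {x : Fin 4 → ℝ} (hdet : IsUnit (g x).det)
    (l X Y : Fin 4 → ℝ) :
    metricAt g x l (fun ν => ∑ μ, ∑ κ, christoffel g ν μ κ x * X μ * Y κ) =
      (1 / 2) * ∑ i, l i * ∑ μ, ∑ κ, (partialD μ (fun y => g y i κ) x
        + partialD κ (fun y => g y i μ) x - partialD i (fun y => g y μ κ) x) * X μ * Y κ := by
  set V : Fin 4 → ℝ := fun i => ∑ μ, ∑ κ, (partialD μ (fun y => g y i κ) x
        + partialD κ (fun y => g y i μ) x - partialD i (fun y => g y μ κ) x) * X μ * Y κ with hV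
  have h1 : (fun ν => ∑ μ, ∑ κ, christoffel g ν μ κ x * X μ * Y κ) =
      (1 / 2 : ℝ) • ((g x)⁻¹.mulVec V) := by
    funext ν
    simp only [christoffel, hV, Pi.smul_apply, Matrix.mulVec, dotProduct, smul_eq_mul,
      Finset.mul_sum, Finset.sum_mul]
    have hcomm : ∀ f : Fin 4 → Fin 4 → Fin 4 → ℝ,
        ∑ μ, ∑ κ, ∑ i, f μ κ i = ∑ i, ∑ μ, ∑ κ, f μ κ i := fun f => by
      rw [Finset.sum_comm]
      exact (Finset.sum_congr rfl fun μ _ => Finset.sum_comm).trans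
        (Finset.sum_comm.trans (Finset.sum_congr rfl fun i _ => Finset.sum_comm))
    rw [hcomm]
    refine Finset.sum_congr rfl fun i _ => Finset.sum_congr rfl fun j _ =>
      Finset.sum_congr rfl fun k _ => ?_
    ring
  have h2 : ∀ w, metricAt g x l w = l ⬝ᵥ (g x).mulVec w := by
    intro w
    simp only [metricAt, Matrix.mulVec, dotProduct, Finset.mul_sum]
    exact Finset.sum_congr rfl fun i _ => Finset.sum_congr rfl fun j _ => by ring
  rw [h1, metricAt_smul_right, h2, Matrix.mulVec_mulVec, Matrix.mul_nonsing_inv _ hdet,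
    Matrix.one_mulVec]
  rfl

/-- For vectors `X`, `Y` with constant components that are Killing vectors,
`2 l · ∇_X Y = - l (X · Y)`. -/
theorem metricAt_christoffel_killing {g : MetricField} {x : Fin 4 → ℝ} (hdet : IsUnit (g x).det)
    (hg : ∀ μ ν, DifferentiableAt ℝ (fun y => g y μ ν) x) {X Y : Fin 4 → ℝ}
    (hX : ∀ μ ν, ∑ κ, X κ * partialD κ (fun y => g y μ ν) x = 0)
    (hY : ∀ μ ν, ∑ κ, Y κ * partialD κ (fun y => g y μ ν) x = 0) (l : Fin 4 → ℝ) :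
    metricAt g x l (fun ν => ∑ μ, ∑ κ, christoffel g ν μ κ x * X μ * Y κ) =
      -(1 / 2) * ∑ i, l i * partialD i (fun y => metricAt g y X Y) x := by
  have hd : ∀ i, partialD i (fun y => metricAt g y X Y) x =
      ∑ μ, ∑ κ, partialD i (fun y => g y μ κ) x * X μ * Y κ := by
    intro i
    refine HasDerivAt.deriv ?_
    refine HasDerivAt.fun_sum fun μ _ => HasDerivAt.fun_sum fun κ _ => ?_
    have := hasDerivAt_comp_update (hg μ κ) i
    rw [partialD_eq_fderiv (hg μ κ)]
    exact (this.mul_const _).mul_const _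
  rw [metricAt_christoffel hdet, neg_mul, ← mul_neg, ← Finset.sum_neg_distrib]
  congr 1
  refine Finset.sum_congr rfl fun i _ => ?_
  rw [hd, ← mul_neg]
  congr 1
  simp only [sub_mul, add_mul, Finset.sum_sub_distrib, Finset.sum_add_distrib]
  have e1 : ∑ μ, ∑ κ, partialD μ (fun y => g y i κ) x * X μ * Y κ = 0 := by
    rw [Finset.sum_comm]
    refine Finset.sum_eq_zero fun κ _ => ?_
    rw [← Finset.sum_mul]
    simp_rw [mul_comm (partialD _ _ _)]
    rw [hX, zero_mul]
  have e2 : ∑ μ, ∑ κ, partialD κ (fun y => g y i μ) x * X μ * Y κ = 0 := by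
    refine Finset.sum_eq_zero fun μ _ => ?_
    have := hY i μ
    calc _ = X μ * ∑ κ, Y κ * partialD κ (fun y => g y i μ) x := by
          rw [Finset.mul_sum]; exact Finset.sum_congr rfl fun κ _ => by ring
      _ = 0 := by rw [this, mul_zero]
  rw [e1, e2]
  ring

/-! ### The junction conditions along Killing vectors -/

theorem differentiableAt_tangentVec {Φ : (Fin 3 → ℝ) → (Fin 4 → ℝ)} {S : Set (Fin 3 → ℝ)}
    (hS : IsOpen S) (hΦ : ContDiffOn ℝ 3 Φ S) {ξ : Fin 3 → ℝ} (hξ : ξ ∈ S) (b : Fin 3)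
    (ν : Fin 4) : DifferentiableAt ℝ (fun η => tangentVec Φ b η ν) ξ := by
  have hν : ∀ η ∈ S, ContDiffAt ℝ 3 (fun η => Φ η ν) η := fun η hη =>
    contDiffAt_pi.1 (hΦ.contDiffAt (hS.mem_nhds hη)) ν
  have h1 : DifferentiableAt ℝ (fun η => fderiv ℝ (fun η => Φ η ν) η (Pi.single b 1)) ξ :=
    (((hν ξ hξ).fderiv_right (m := 1) (by norm_num)).differentiableAt (by norm_num)).clm_apply
      (differentiableAt_const _)
  refine h1.congr_of_eventuallyEq ?_
  filter_upwards [hS.mem_nhds hξ] with η hη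
  exact partialD_eq_fderiv ((hν η hη).differentiableAt (by norm_num)) b

theorem sum_partialD_tangentVec_of_pushForward_const {Φ : (Fin 3 → ℝ) → (Fin 4 → ℝ)}
    {S : Set (Fin 3 → ℝ)} (hS : IsOpen S) (hΦ : ContDiffOn ℝ 3 Φ S)
    {γ : (Fin 3 → ℝ) → (Fin 3 → ℝ)} (hγ : ContDiffOn ℝ 2 γ S) {Z : Fin 4 → ℝ}
    (hZ : ∀ ξ ∈ S, pushForward Φ γ ξ = Z) {ξ : Fin 3 → ℝ} (hξ : ξ ∈ S) (a : Fin 3) (ν : Fin 4) :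
    ∑ b, γ ξ b * partialD a (fun η => tangentVec Φ b η ν) ξ =
      -∑ b, partialD a (fun η => γ η b) ξ * tangentVec Φ b ξ ν := by
  have hγd : ∀ b, DifferentiableAt ℝ (fun η => γ η b) ξ := fun b =>
    differentiableAt_pi.1
      ((hγ.contDiffAt (hS.mem_nhds hξ)).differentiableAt (by norm_num)) b
  have hc : partialD a (fun η => ∑ b, γ η b * tangentVec Φ b η ν) ξ = 0 := by
    have : (fun η => ∑ b, γ η b * tangentVec Φ b η ν) =ᶠ[nhds ξ] fun _ => Z ν := by
      filter_upwards [hS.mem_nhds hξ] with η hη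
      rw [← hZ η hη]
      simp [pushForward]
    rw [partialD_congr this]
    simp [partialD]
  have hd : partialD a (fun η => ∑ b, γ η b * tangentVec Φ b η ν) ξ =
      ∑ b, (partialD a (fun η => γ η b) ξ * tangentVec Φ b ξ ν +
        γ ξ b * partialD a (fun η => tangentVec Φ b η ν) ξ) := by
    refine HasDerivAt.deriv (HasDerivAt.fun_sum fun b _ => ?_)
    have ht := differentiableAt_tangentVec hS hΦ hξ b ν
    have := (hasDerivAt_comp_update (hγd b) a).fun_mul (hasDerivAt_comp_update ht a)
    rw [partialD_eq_fderiv (hγd b), partialD_eq_fderiv ht]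
    simpa using this
  rw [hd, Finset.sum_add_distrib] at hc
  linarith

/-- The second fundamental form along two symmetry generators, in terms of `∇_{Z₁} Z₂` and of
scalar products of the rigging with tangent vectors. -/
theorem sum_secondForm {g : MetricField} {Φ l : (Fin 3 → ℝ) → (Fin 4 → ℝ)}
    {S : Set (Fin 3 → ℝ)} (hS : IsOpen S) (hΦ : ContDiffOn ℝ 3 Φ S)
    {γ₁ γ₂ : (Fin 3 → ℝ) → (Fin 3 → ℝ)} (hγ₂ : ContDiffOn ℝ 2 γ₂ S) {Z₁ Z₂ : Fin 4 → ℝ}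
    (h₁ : ∀ ξ ∈ S, pushForward Φ γ₁ ξ = Z₁) (h₂ : ∀ ξ ∈ S, pushForward Φ γ₂ ξ = Z₂)
    {ξ : Fin 3 → ℝ} (hξ : ξ ∈ S) :
    ∑ a, ∑ b, γ₁ ξ a * γ₂ ξ b * secondForm g Φ l a b ξ =
      (∑ a, ∑ b, γ₁ ξ a * partialD a (fun η => γ₂ η b) ξ *
        metricAt g (Φ ξ) (l ξ) (tangentVec Φ b ξ)) -
      metricAt g (Φ ξ) (l ξ) (fun ν => ∑ μ, ∑ κ, christoffel g ν μ κ (Φ ξ) * Z₁ μ * Z₂ κ) := by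
  have hν : ∀ ν, ∑ a, ∑ b, γ₁ ξ a * γ₂ ξ b *
      (partialD a (fun η => tangentVec Φ b η ν) ξ
        + ∑ μ, ∑ κ, christoffel g ν μ κ (Φ ξ) * tangentVec Φ a ξ μ * tangentVec Φ b ξ κ) =
      -(∑ a, ∑ b, γ₁ ξ a * partialD a (fun η => γ₂ η b) ξ * tangentVec Φ b ξ ν) +
        ∑ μ, ∑ κ, christoffel g ν μ κ (Φ ξ) * Z₁ μ * Z₂ κ := by
    intro ν
    have e1 := metricAt_sum_sum (fun _ => Matrix.of fun μ κ => christoffel g ν μ κ (Φ ξ)) 0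
      (γ₁ ξ) (γ₂ ξ) (fun a => tangentVec Φ a ξ) (fun a => tangentVec Φ a ξ)
    have e2 : ∑ a, γ₁ ξ a • tangentVec Φ a ξ = Z₁ := h₁ ξ hξ
    have e3 : ∑ a, γ₂ ξ a • tangentVec Φ a ξ = Z₂ := h₂ ξ hξ
    rw [e2, e3] at e1
    simp only [metricAt, Matrix.of_apply] at e1
    rw [e1]
    simp only [mul_add, Finset.sum_add_distrib]
    congr 1
    rw [← Finset.sum_neg_distrib]
    refine Finset.sum_congr rfl fun a _ => ?_
    have e4 := sum_partialD_tangentVec_of_pushForward_const hS hΦ hγ₂ h₂ hξ a ν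
    simp only [mul_assoc]
    rw [← Finset.mul_sum, e4, mul_neg, Finset.mul_sum]
  have hsum : ∑ a, ∑ b, γ₁ ξ a * γ₂ ξ b * secondForm g Φ l a b ξ =
      -metricAt g (Φ ξ) (l ξ) (fun ν => ∑ a, ∑ b, γ₁ ξ a * γ₂ ξ b *
      (partialD a (fun η => tangentVec Φ b η ν) ξ
        + ∑ μ, ∑ κ, christoffel g ν μ κ (Φ ξ) * tangentVec Φ a ξ μ * tangentVec Φ b ξ κ)) := by
    have := metricAt_sum_right g (Φ ξ) (l ξ) (fun q : Fin 3 × Fin 3 => γ₁ ξ q.1 * γ₂ ξ q.2)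
      (fun q ν => partialD q.1 (fun η => tangentVec Φ q.2 η ν) ξ
        + ∑ μ, ∑ κ, christoffel g ν μ κ (Φ ξ) * tangentVec Φ q.1 ξ μ * tangentVec Φ q.2 ξ κ)
    rw [Fintype.sum_prod_type, Fintype.sum_prod_type] at this
    simp only [secondForm, mul_neg, Finset.sum_neg_distrib]
    rw [← this]
    congr 2
  rw [hsum, funext hν]
  have hsplit : (fun ν => -(∑ a, ∑ b, γ₁ ξ a * partialD a (fun η => γ₂ η b) ξ *
        tangentVec Φ b ξ ν) + ∑ μ, ∑ κ, christoffel g ν μ κ (Φ ξ) * Z₁ μ * Z₂ κ) =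
      (-1 : ℝ) • (∑ q : Fin 3 × Fin 3, (γ₁ ξ q.1 * partialD q.1 (fun η => γ₂ η q.2) ξ) •
        tangentVec Φ q.2 ξ) +
      fun ν => ∑ μ, ∑ κ, christoffel g ν μ κ (Φ ξ) * Z₁ μ * Z₂ κ := by
    funext ν
    rw [Fintype.sum_prod_type]
    simp [Finset.sum_apply]
  rw [hsplit, metricAt_add_right, metricAt_smul_right, metricAt_sum_right, Fintype.sum_prod_type]
  ring

/-- Across a matching the symmetry generators `Z₁`, `Z₂` carry over together with the differential
of their scalar product: the tangential derivatives agree by the equality of the first fundamental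
forms, the derivative along the rigging by the equality of the second ones.  Identifying the
tangent spaces through `e_a` and the rigging, one obtains for each vector `w` on the second side a
vector `v` of the same norm on the first side along which the scalar products of the generators
have the same derivatives. -/
theorem Matching.exists_corresponding_vector {gp gm : MetricField} {Up Um : Set (Fin 4 → ℝ)}
    (σ : Matching gp Up gm Um) {ι : Type*} (γ : ι → (Fin 3 → ℝ) → (Fin 3 → ℝ))
    (hγ : ∀ i, ContDiffOn ℝ 2 (γ i) σ.S) (Zp Zm : ι → Fin 4 → ℝ)
    (hp : ∀ i, ∀ ξ ∈ σ.S, pushForward σ.Φp (γ i) ξ = Zp i)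
    (hm : ∀ i, ∀ ξ ∈ σ.S, pushForward σ.Φm (γ i) ξ = Zm i)
    {ξ : Fin 3 → ℝ} (hξ : ξ ∈ σ.S)
    (hsp : (gp (σ.Φp ξ)).IsSymm) (hsm : (gm (σ.Φm ξ)).IsSymm)
    (hdp : IsUnit (gp (σ.Φp ξ)).det) (hdm : IsUnit (gm (σ.Φm ξ)).det)
    (hgp : ∀ μ ν, DifferentiableAt ℝ (fun y => gp y μ ν) (σ.Φp ξ))
    (hgm : ∀ μ ν, DifferentiableAt ℝ (fun y => gm y μ ν) (σ.Φm ξ))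
    (hKp : ∀ i μ ν, ∑ κ, Zp i κ * partialD κ (fun y => gp y μ ν) (σ.Φp ξ) = 0)
    (hKm : ∀ i μ ν, ∑ κ, Zm i κ * partialD κ (fun y => gm y μ ν) (σ.Φm ξ) = 0)
    (w : Fin 4 → ℝ) :
    ∃ v : Fin 4 → ℝ, metricAt gp (σ.Φp ξ) v v = metricAt gm (σ.Φm ξ) w w ∧
      ∀ i j, ∑ κ, v κ * partialD κ (fun y => metricAt gp y (Zp i) (Zp j)) (σ.Φp ξ) =
        ∑ κ, w κ * partialD κ (fun y => metricAt gm y (Zm i) (Zm j)) (σ.Φm ξ) := by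
  obtain ⟨c, d, hw⟩ : ∃ (c : Fin 3 → ℝ) (d : ℝ),
      w = (∑ a, c a • tangentVec σ.Φm a ξ) + d • σ.lm ξ := by
    have hli := linearIndependent_finCons.2 ⟨σ.rank_m ξ hξ, σ.transversal_m ξ hξ⟩
    have htop := hli.span_eq_top_of_card_eq_finrank' (by simp)
    have hmem : w ∈ Submodule.span ℝ (Set.range
        (Fin.cons (σ.lm ξ) (fun a => tangentVec σ.Φm a ξ) : Fin 4 → Fin 4 → ℝ)) :=
      htop ▸ Submodule.mem_top
    rw [Fin.range_cons, Submodule.mem_span_insert] at hmem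
    obtain ⟨d, z, hz, rfl⟩ := hmem
    obtain ⟨c, rfl⟩ := (Submodule.mem_span_range_iff_exists_fun ℝ).1 hz
    exact ⟨c, d, add_comm _ _⟩
  refine ⟨(∑ a, c a • tangentVec σ.Φp a ξ) + d • σ.lp ξ, ?_, fun i j => ?_⟩
  · have e1 := σ.first_form ξ hξ
    have e2 := σ.rigging_norm ξ hξ
    have e3 := σ.rigging_tangent ξ hξ
    rw [hw]
    simp only [metricAt_add_left, metricAt_add_right, metricAt_smul_left, metricAt_smul_right]
    simp only [metricAt_sum_sum]
    rw [metricAt_comm hsp (∑ a, _) (σ.lp ξ), metricAt_comm hsm (∑ a, _) (σ.lm ξ)]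
    simp only [metricAt_sum_right, e1, e2, e3]
  · have hSn := σ.isOpen_S.mem_nhds hξ
    have hΦp := (σ.contDiffOn_p.contDiffAt hSn).differentiableAt (by norm_num)
    have hΦm := (σ.contDiffOn_m.contDiffAt hSn).differentiableAt (by norm_num)
    have hprod : ∀ (g : MetricField) (x X Y : Fin 4 → ℝ),
        (∀ μ ν, DifferentiableAt ℝ (fun y => g y μ ν) x) →
        DifferentiableAt ℝ (fun y => metricAt g y X Y) x := fun g x X Y h => by
      unfold metricAt
      fun_prop
    have hfp := hprod gp _ (Zp i) (Zp j) hgp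
    have hfm := hprod gm _ (Zm i) (Zm j) hgm
    have htan : ∀ a, ∑ κ, tangentVec σ.Φp a ξ κ *
          partialD κ (fun y => metricAt gp y (Zp i) (Zp j)) (σ.Φp ξ) =
        ∑ κ, tangentVec σ.Φm a ξ κ *
          partialD κ (fun y => metricAt gm y (Zm i) (Zm j)) (σ.Φm ξ) := by
      intro a
      have h1 := partialD_comp hfp hΦp a
      have h2 := partialD_comp hfm hΦm a
      unfold tangentVec
      rw [← h1, ← h2]
      refine partialD_congr ?_ a
      filter_upwards [hSn] with η hη
      rw [← hp i η hη, ← hp j η hη, ← hm i η hη, ← hm j η hη]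
      simp only [pushForward, metricAt_sum_sum, σ.first_form η hη]
    have hrig : ∑ κ, σ.lp ξ κ *
          partialD κ (fun y => metricAt gp y (Zp i) (Zp j)) (σ.Φp ξ) =
        ∑ κ, σ.lm ξ κ *
          partialD κ (fun y => metricAt gm y (Zm i) (Zm j)) (σ.Φm ξ) := by
      have h1 := sum_secondForm (g := gp) (l := σ.lp) σ.isOpen_S σ.contDiffOn_p (hγ j)
        (hp i) (hp j) hξ
      have h2 := sum_secondForm (g := gm) (l := σ.lm) σ.isOpen_S σ.contDiffOn_m (hγ j)
        (hm i) (hm j) hξ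
      rw [metricAt_christoffel_killing hdp hgp (hKp i) (hKp j)] at h1
      rw [metricAt_christoffel_killing hdm hgm (hKm i) (hKm j)] at h2
      simp only [σ.second_form ξ hξ, σ.rigging_tangent ξ hξ] at h1
      linarith
    have hlin : ∀ (e : Fin 3 → Fin 4 → ℝ) (l G : Fin 4 → ℝ),
        ∑ κ, ((∑ a, c a • e a) + d • l) κ * G κ =
          ∑ a, c a * (∑ κ, e a κ * G κ) + d * ∑ κ, l κ * G κ := by
      intro e l G
      simp only [Pi.add_apply, Finset.sum_apply, Pi.smul_apply, smul_eq_mul, add_mul,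
        Finset.sum_add_distrib, Finset.mul_sum, Finset.sum_mul]
      rw [Finset.sum_comm]
      simp only [mul_assoc]
    rw [hw, hlin, hlin, hrig]
    simp only [htan]

/-! ### The two families of metrics -/

/-- The derivative of `Σ(·,k)`: `cos y`, `1`, `cosh y` for `k = 1, 0, -1`. -/
noncomputable def sigmaDeriv (k : ℤ) (y : ℝ) : ℝ :=
  if k = 1 then Real.cos y else if k = 0 then 1 else Real.cosh y

theorem hasDerivAt_sigmaFn (k : ℤ) (y : ℝ) : HasDerivAt (sigmaFn k) (sigmaDeriv k y) y := by
  unfold sigmaFn sigmaDeriv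
  split_ifs
  · exact Real.hasDerivAt_sin y
  · exact hasDerivAt_id y
  · exact Real.hasDerivAt_sinh y

theorem hasDerivAt_fFn (k : ℤ) (y : ℝ) : HasDerivAt (fFn k) (sigmaFn k y) y := by
  unfold sigmaFn fFn
  split_ifs
  · simpa using (Real.hasDerivAt_cos y).fun_neg
  · simpa using (hasDerivAt_pow 2 y).div_const 2
  · exact Real.hasDerivAt_cosh y

theorem hasDerivAt_sigmaDeriv {k : ℤ} (hk : k = 1 ∨ k = 0 ∨ k = -1) (y : ℝ) :
    HasDerivAt (sigmaDeriv k) (-(k : ℝ) * sigmaFn k y) y := by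
  unfold sigmaFn sigmaDeriv
  rcases hk with rfl | rfl | rfl
  · simpa using Real.hasDerivAt_cos y
  · simpa using hasDerivAt_const y (1 : ℝ)
  · simpa using Real.hasDerivAt_cosh y

theorem sigmaDeriv_sq_add {k : ℤ} (hk : k = 1 ∨ k = 0 ∨ k = -1) (y : ℝ) :
    sigmaDeriv k y ^ 2 + k * sigmaFn k y ^ 2 = 1 := by
  unfold sigmaFn sigmaDeriv
  rcases hk with rfl | rfl | rfl
  · simp
  · simp
  · simp [Real.cosh_sq]

theorem sigmaFn_pos {k : ℤ} {y : ℝ} (hy : 0 < y) (h1 : k = 1 → y < Real.pi) :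
    0 < sigmaFn k y := by
  unfold sigmaFn
  split_ifs with h
  · exact Real.sin_pos_of_pos_of_lt_pi hy (h1 h)
  · exact hy
  · exact Real.sinh_pos_iff.2 hy

theorem metricAt_single (g : MetricField) (x : Fin 4 → ℝ) (i j : Fin 4) :
    metricAt g x (Pi.single i 1) (Pi.single j 1) = g x i j := by
  simp [metricAt, Pi.single_apply]

/-- Differentiation of a function of the first two coordinates along a vector. -/
theorem sum_partialD_of_two_variables {f : (Fin 4 → ℝ) → ℝ} (h : ℝ → ℝ → ℝ)
    (hf : ∀ y, f y = h (y 0) (y 1)) {x : Fin 4 → ℝ} {d₀ d₁ : ℝ}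
    (h₀ : HasDerivAt (fun t => h t (x 1)) d₀ (x 0)) (h₁ : HasDerivAt (fun r => h (x 0) r) d₁ (x 1))
    (v : Fin 4 → ℝ) :
    ∑ κ, v κ * partialD κ f x = v 0 * d₀ + v 1 * d₁ := by
  rw [Fin.sum_univ_four]
  have e0 : partialD 0 f x = d₀ := by simpa [partialD, hf] using h₀.deriv
  have e1 : partialD 1 f x = d₁ := by simpa [partialD, hf] using h₁.deriv
  have e2 : partialD 2 f x = 0 := by simp [partialD, hf]
  have e3 : partialD 3 f x = 0 := by simp [partialD, hf]
  rw [e0, e1, e2, e3]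
  ring

namespace LRSSpacetime

variable (M : LRSSpacetime)

theorem isSymm_metric (x : Fin 4 → ℝ) : (M.metric x).IsSymm := by
  ext i j
  fin_cases i <;> fin_cases j <;> simp [metric]

theorem det_metric (x : Fin 4 → ℝ) :
    (M.metric x).det = -(M.a (x 0) ^ 2 * M.b (x 0) ^ 4 * sigmaFn M.k (x 1) ^ 2) := by
  simp [metric, Matrix.det_succ_row_zero, Fin.sum_univ_succ, Fin.succAbove]
  ring

variable {M}

theorem sigma_pos {x : Fin 4 → ℝ} (hx : x ∈ M.domain) : 0 < sigmaFn M.k (x 1) :=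
  sigmaFn_pos hx.2.1 hx.2.2

theorem isUnit_det_metric {x : Fin 4 → ℝ} (hx : x ∈ M.domain) : IsUnit (M.metric x).det := by
  rw [det_metric, isUnit_iff_ne_zero, neg_ne_zero]
  have h1 := M.a_pos _ hx.1
  have h2 := M.b_pos _ hx.1
  have h3 := sigma_pos hx
  positivity

theorem hasDerivAt_a {t : ℝ} (ht : t ∈ M.I) : HasDerivAt M.a (deriv M.a t) t :=
  ((M.contDiffOn_a.contDiffAt (M.isOpen_I.mem_nhds ht)).differentiableAt (by norm_num)).hasDerivAt

theorem hasDerivAt_b {t : ℝ} (ht : t ∈ M.I) : HasDerivAt M.b (deriv M.b t) t :=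
  ((M.contDiffOn_b.contDiffAt (M.isOpen_I.mem_nhds ht)).differentiableAt (by norm_num)).hasDerivAt

theorem differentiableAt_metric {x : Fin 4 → ℝ} (hx : x ∈ M.domain) (μ ν : Fin 4) :
    DifferentiableAt ℝ (fun y => M.metric y μ ν) x := by
  have ha : DifferentiableAt ℝ (fun y : Fin 4 → ℝ => M.a (y 0)) x :=
    DifferentiableAt.comp x (hasDerivAt_a hx.1).differentiableAt (differentiableAt_apply 0 x)
  have hb : DifferentiableAt ℝ (fun y : Fin 4 → ℝ => M.b (y 0)) x :=
    DifferentiableAt.comp x (hasDerivAt_b hx.1).differentiableAt (differentiableAt_apply 0 x)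
  have hs : DifferentiableAt ℝ (fun y : Fin 4 → ℝ => sigmaFn M.k (y 1)) x :=
    DifferentiableAt.comp (g := sigmaFn M.k) x (hasDerivAt_sigmaFn M.k (x 1)).differentiableAt
      (differentiableAt_apply 1 x)
  have hf : DifferentiableAt ℝ (fun y : Fin 4 → ℝ => fFn M.k (y 1)) x :=
    DifferentiableAt.comp (g := fFn M.k) x (hasDerivAt_fFn M.k (x 1)).differentiableAt
      (differentiableAt_apply 1 x)
  fin_cases μ <;> fin_cases ν <;> simp [metric] <;> fun_prop

theorem eq_zero_of_metricAt_self_nonpos {x v : Fin 4 → ℝ} (hx : x ∈ M.domain) (h0 : v 0 = 0)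
    (hv : metricAt M.metric x v v ≤ 0) : v = 0 := by
  have h1 := M.a_pos _ hx.1
  have h2 := M.b_pos _ hx.1
  have h3 := sigma_pos hx
  rw [metricAt_self, h0] at hv
  set P := M.n * (fFn M.k (x 1) + (M.k : ℝ))
  have p1 : 0 ≤ M.a (x 0) ^ 2 * (v 3 + P * v 2) ^ 2 := by positivity
  have p2 : 0 ≤ M.b (x 0) ^ 2 * (v 1 - M.ε * x 1 * v 3) ^ 2 := by positivity
  have p3 : 0 ≤ M.b (x 0) ^ 2 * (sigmaFn M.k (x 1) ^ 2 * v 2 ^ 2) := by positivity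
  have e3 : M.b (x 0) ^ 2 * (sigmaFn M.k (x 1) ^ 2 * v 2 ^ 2) = 0 := by nlinarith
  have e2 : M.b (x 0) ^ 2 * (v 1 - M.ε * x 1 * v 3) ^ 2 = 0 := by nlinarith
  have e1 : M.a (x 0) ^ 2 * (v 3 + P * v 2) ^ 2 = 0 := by nlinarith
  have f2 : v 2 = 0 := by simpa [h2.ne', h3.ne'] using e3
  have f3 : v 3 = 0 := by simpa [h1.ne', f2] using e1
  have f1 : v 1 = 0 := by simpa [h2.ne', f3] using e2
  funext i
  fin_cases i <;> simp [h0, f1, f2, f3]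

/-- A timelike vector along which the scalar products of `∂_φ` and `∂_z` are stationary forces
`a` to be stationary, and `b` as well if `n = 1`. -/
theorem deriv_eq_zero_of_timelike {x v : Fin 4 → ℝ} (hx : x ∈ M.domain)
    (hv : metricAt M.metric x v v < 0)
    (h22 : ∑ κ, v κ * partialD κ (fun y => M.metric y 2 2) x = 0)
    (h23 : ∑ κ, v κ * partialD κ (fun y => M.metric y 2 3) x = 0)
    (h33 : ∑ κ, v κ * partialD κ (fun y => M.metric y 3 3) x = 0) :
    deriv M.a (x 0) = 0 ∧ (M.n = 1 → deriv M.b (x 0) = 0) := by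
  have hv0 : v 0 ≠ 0 := by
    intro h0
    have h := eq_zero_of_metricAt_self_nonpos hx h0 hv.le
    rw [h] at hv
    simp [metricAt] at hv
  have h1 := M.a_pos _ hx.1
  have h2 := M.b_pos _ hx.1
  have h3 := sigma_pos hx
  have da := hasDerivAt_a hx.1
  have db := hasDerivAt_b hx.1
  have ds := hasDerivAt_sigmaFn M.k (x 1)
  have df := hasDerivAt_fFn M.k (x 1)
  have dP := (df.add_const (M.k : ℝ)).const_mul M.n
  rw [sum_partialD_of_two_variables (fun t r => M.a t ^ 2 * (M.n * (fFn M.k r + (M.k : ℝ))) ^ 2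
    + M.b t ^ 2 * sigmaFn M.k r ^ 2) (fun y => by simp [metric])
    (((da.fun_pow 2).mul_const _).add ((db.fun_pow 2).mul_const _))
    (((dP.fun_pow 2).const_mul _).add ((ds.fun_pow 2).const_mul _))] at h22
  rw [sum_partialD_of_two_variables (fun t r => M.a t ^ 2 * (M.n * (fFn M.k r + (M.k : ℝ))))
    (fun y => by simp [metric]) ((da.fun_pow 2).mul_const _) (dP.const_mul _)] at h23
  rw [sum_partialD_of_two_variables (fun t r => M.a t ^ 2 + M.b t ^ 2 * (M.ε * r) ^ 2)
    (fun y => by simp [metric]) ((da.fun_pow 2).add ((db.fun_pow 2).mul_const _))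
    (((((hasDerivAt_id (x 1)).const_mul M.ε).fun_pow 2).const_mul _).const_add _)] at h33
  simp only [Nat.cast_ofNat, Nat.add_one_sub_one, pow_one, id_eq, mul_one] at h22 h23 h33
  rcases M.n_eq with hn | hn
  · refine ⟨?_, fun h => by rw [hn] at h; norm_num at h⟩
    rw [hn] at h22
    rcases M.ε_eq with hε | hε
    · rw [hε] at h33
      have : v 0 * (M.a (x 0) * deriv M.a (x 0)) = 0 := by linarith
      simpa [hv0, h1.ne'] using this
    · have hk : M.k = 0 := by
        have := M.ε_mul_k
        rw [hε, one_mul] at this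
        exact_mod_cast this
      have hs : sigmaFn M.k (x 1) = x 1 := by simp [sigmaFn, hk]
      have hs' : sigmaDeriv M.k (x 1) = 1 := by simp [sigmaDeriv, hk]
      rw [hs, hs'] at h22
      rw [hε] at h33
      have : v 0 * (M.a (x 0) * deriv M.a (x 0)) = 0 := by linarith
      simpa [hv0, h1.ne'] using this
  · have hε : M.ε = 0 := by
      have := M.ε_mul_n
      rwa [hn, mul_one] at this
    rw [hε] at h33
    rw [hn] at h22 h23
    have a0 : deriv M.a (x 0) = 0 := by
      have : v 0 * (M.a (x 0) * deriv M.a (x 0)) = 0 := by linarith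
      simpa [hv0, h1.ne'] using this
    rw [a0] at h22 h23
    have v1 : v 1 = 0 := by
      have : v 1 * (M.a (x 0) ^ 2 * sigmaFn M.k (x 1)) = 0 := by linarith
      simpa [h1.ne', h3.ne'] using this
    rw [v1] at h22
    refine ⟨a0, fun _ => ?_⟩
    have : v 0 * (M.b (x 0) * deriv M.b (x 0) * sigmaFn M.k (x 1) ^ 2) = 0 := by linarith
    simpa [hv0, h2.ne', h3.ne'] using this

end LRSSpacetime

namespace StaticCylindrical

variable {N : StaticCylindrical}

theorem isSymm_metric (N : StaticCylindrical) (x : Fin 4 → ℝ) : (N.metric x).IsSymm := by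
  ext i j
  fin_cases i <;> fin_cases j <;> simp [metric]

theorem isUnit_det_metric {x : Fin 4 → ℝ} (hx : x ∈ N.domain) : IsUnit (N.metric x).det := by
  have h : (N.metric x).det =
      -(N.A (x 1) ^ 2 * N.B (x 1) ^ 2 * (N.C (x 1) ^ 2 * N.D (x 1) ^ 2 - N.E (x 1) ^ 2)) := by
    simp [metric, Matrix.det_succ_row_zero, Fin.sum_univ_succ, Fin.succAbove]
    ring
  rw [h, isUnit_iff_ne_zero, neg_ne_zero]
  have h1 := N.A_pos _ hx
  have h2 := N.B_pos _ hx
  have h3 := N.orbits_spacelike _ hx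
  positivity

theorem differentiableAt_metric {x : Fin 4 → ℝ} (hx : x ∈ N.domain) (μ ν : Fin 4) :
    DifferentiableAt ℝ (fun y => N.metric y μ ν) x := by
  have hd : ∀ f : ℝ → ℝ, ContDiffOn ℝ 2 f N.K →
      DifferentiableAt ℝ (fun y : Fin 4 → ℝ => f (y 1)) x := fun f hf =>
    DifferentiableAt.comp x
      ((hf.contDiffAt (N.isOpen_K.mem_nhds hx)).differentiableAt (by norm_num))
      (differentiableAt_apply 1 x)
  have hA := hd _ N.contDiffOn_A
  have hB := hd _ N.contDiffOn_B
  have hC := hd _ N.contDiffOn_C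
  have hD := hd _ N.contDiffOn_D
  have hE := hd _ N.contDiffOn_E
  fin_cases μ <;> fin_cases ν <;> simp [metric] <;> fun_prop

end StaticCylindrical

/-! ### The time range of the matching hypersurface -/

section TimeRange

variable {M : LRSSpacetime} {N : StaticCylindrical}
  {σ : Matching M.metric M.domain N.metric N.domain}

/-- Wherever a symmetry-preserving matching to a static spacetime is possible, the scale function
`a` is stationary, and for `n = 1` so is `b`: the vector corresponding to the static Killing vector
`∂_T` is timelike and annihilates the scalar products of the symmetry generators. -/
theorem deriv_eq_zero_of_preservesCylindricalSymmetry
    (hσ : PreservesCylindricalSymmetry M N σ) {ξ : Fin 3 → ℝ} (hξ : ξ ∈ σ.S) :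
    deriv M.a (σ.Φp ξ 0) = 0 ∧ (M.n = 1 → deriv M.b (σ.Φp ξ 0) = 0) := by
  obtain ⟨γ₁, γ₂, hγ₁, hγ₂, a, b, c, h⟩ := hσ
  have hxp := σ.mapsTo_p hξ
  have hxm := σ.mapsTo_m hξ
  have hKp : ∀ (i : Fin 4), i = 2 ∨ i = 3 → ∀ μ ν : Fin 4,
      partialD i (fun y => M.metric y μ ν) (σ.Φp ξ) = 0 := by
    rintro i (rfl | rfl) μ ν <;> simp [partialD, LRSSpacetime.metric]
  have hKm : ∀ (i : Fin 4), i ≠ 1 → ∀ μ ν : Fin 4,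
      partialD i (fun y => N.metric y μ ν) (σ.Φm ξ) = 0 := by
    intro i hi μ ν
    simp [partialD, StaticCylindrical.metric, Function.update_of_ne hi.symm]
  obtain ⟨v, hv, hG⟩ := σ.exists_corresponding_vector ![γ₁, γ₂]
    (by intro i; fin_cases i <;> assumption)
    ![Pi.single 2 1, Pi.single 3 1]
    ![Pi.single 2 1, a • Pi.single 2 1 + b • Pi.single 3 1 + c • Pi.single 0 1]
    (by
      intro i ξ hξ
      fin_cases i
      · exact (h ξ hξ).1
      · exact (h ξ hξ).2.2.1)
    (by
      intro i ξ hξ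
      fin_cases i
      · exact (h ξ hξ).2.1
      · exact (h ξ hξ).2.2.2) hξ
    (M.isSymm_metric _) (N.isSymm_metric _) (LRSSpacetime.isUnit_det_metric hxp)
    (StaticCylindrical.isUnit_det_metric hxm) (LRSSpacetime.differentiableAt_metric hxp)
    (StaticCylindrical.differentiableAt_metric hxm)
    (by
      intro i μ ν
      have e2 := hKp 2 (by simp) μ ν
      have e3 := hKp 3 (by simp) μ ν
      fin_cases i <;> simp [Fin.sum_univ_four, e2, e3])
    (by
      intro i μ ν
      have e0 := hKm 0 (by decide) μ ν
      have e2 := hKm 2 (by decide) μ ν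
      have e3 := hKm 3 (by decide) μ ν
      fin_cases i <;> simp [Fin.sum_univ_four, e0, e2, e3])
    (Pi.single 0 1)
  have hzero : ∀ i j : Fin 2, ∑ κ, v κ * partialD κ (fun y => metricAt M.metric y
      ((![Pi.single 2 1, Pi.single 3 1] : Fin 2 → Fin 4 → ℝ) i)
      ((![Pi.single 2 1, Pi.single 3 1] : Fin 2 → Fin 4 → ℝ) j)) (σ.Φp ξ) = 0 := by
    intro i j
    rw [hG]
    simp [Fin.sum_univ_four, partialD, metricAt, StaticCylindrical.metric]
  refine LRSSpacetime.deriv_eq_zero_of_timelike hxp (v := v) ?_ ?_ ?_ ?_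
  · rw [hv, metricAt_single]
    have := N.A_pos _ hxm
    simp only [StaticCylindrical.metric, Matrix.of_apply, Matrix.cons_val_zero, Left.neg_neg_iff]
    positivity
  · simpa [metricAt_single] using hzero 0 0
  · simpa [metricAt_single] using hzero 0 1
  · simpa [metricAt_single] using hzero 1 1

theorem timeRange_subset : σ.timeRange ⊆ M.I := by
  rintro _ ⟨ξ, hξ, rfl⟩
  exact (σ.mapsTo_p hξ).1

theorem isPreconnected_timeRange : IsPreconnected σ.timeRange := by
  refine σ.isConnected_S.isPreconnected.image _ ?_
  exact (continuous_apply 0).comp_continuousOn σ.contDiffOn_p.continuousOn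

/-- On a nowhere spacelike hypersurface `dt` does not vanish, so that `t` takes an open set of
values. -/
theorem isOpen_timeRange (hσ : σ.NonSpacelike) : IsOpen σ.timeRange := by
  rw [isOpen_iff_mem_nhds]
  rintro _ ⟨ξ, hξ, rfl⟩
  obtain ⟨a, ha⟩ : ∃ a, tangentVec σ.Φp a ξ 0 ≠ 0 := by
    by_contra! hc
    obtain ⟨v, hv, hv0, hvn⟩ := hσ ξ hξ
    obtain ⟨c, rfl⟩ := (Submodule.mem_span_range_iff_exists_fun ℝ).1 hv
    exact hv0 (LRSSpacetime.eq_zero_of_metricAt_self_nonpos (σ.mapsTo_p hξ) (by simp [hc]) hvn)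
  have hS := σ.isOpen_S.mem_nhds hξ
  have hc : ContDiffAt ℝ 3 (fun η => σ.Φp η 0) ξ :=
    contDiffAt_pi.1 (σ.contDiffOn_p.contDiffAt hS) 0
  have hline : ContDiff ℝ 3 (fun s : ℝ => Function.update ξ a s) := contDiff_update 3 ξ a
  have hf : ContDiffAt ℝ 3 (fun s : ℝ => σ.Φp (Function.update ξ a s) 0) (ξ a) := by
    refine ContDiffAt.comp (g := fun η => σ.Φp η 0) (ξ a) ?_ hline.contDiffAt
    rwa [Function.update_eq_self]
  have hst := hf.hasStrictDerivAt (by norm_num)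
  have hmap := hst.map_nhds_eq ha
  rw [Function.update_eq_self] at hmap
  rw [← hmap, Filter.mem_map]
  have ht : Filter.Tendsto (fun s : ℝ => Function.update ξ a s) (nhds (ξ a)) (nhds ξ) := by
    have := hline.continuous.tendsto (ξ a)
    rwa [Function.update_eq_self] at this
  filter_upwards [ht hS] with s hs
  exact ⟨_, hs, rfl⟩

end TimeRange

/-! ### The Ricci tensor of a perfect fluid -/

/-- Einstein's equations for a perfect fluid, solved for the Ricci tensor. -/
theorem IsPerfectFluidAt.ricci_eq {g : MetricField} {x u : Fin 4 → ℝ} {ρ p : ℝ}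
    (h : IsPerfectFluidAt g x ρ p u) (hs : (g x).IsSymm) (hdet : IsUnit (g x).det)
    (μ ν : Fin 4) :
    ricci g μ ν x =
      (ρ + p) * lowerIndex g x u μ * lowerIndex g x u ν + (ρ - p) / 2 * g x μ ν := by
  obtain ⟨hu, -, hG⟩ := h
  have htr : ∑ μ, ∑ ν, (g x)⁻¹ μ ν * g x μ ν = 4 := by
    have h1 : ((g x)⁻¹ * g x).trace = 4 := by
      rw [Matrix.nonsing_inv_mul _ hdet, Matrix.trace_one]
      simp
    rw [← h1]
    simp only [Matrix.trace, Matrix.diag, Matrix.mul_apply]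
    exact Finset.sum_congr rfl fun i _ => Finset.sum_congr rfl fun j _ => by rw [hs.apply]
  have huu : ∑ μ, ∑ ν, (g x)⁻¹ μ ν * (lowerIndex g x u μ * lowerIndex g x u ν) = -1 := by
    have h1 : (g x)⁻¹.mulVec (lowerIndex g x u) = u := by
      have : lowerIndex g x u = (g x).mulVec u := by
        funext i
        simp [lowerIndex, Matrix.mulVec, dotProduct]
      rw [this, Matrix.mulVec_mulVec, Matrix.nonsing_inv_mul _ hdet, Matrix.one_mulVec]
    rw [← hu]
    have h2 : ∀ μ, ∑ ν, (g x)⁻¹ μ ν * (lowerIndex g x u μ * lowerIndex g x u ν) =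
        lowerIndex g x u μ * u μ := by
      intro μ
      conv_rhs => rw [← congrFun h1 μ]
      simp only [Matrix.mulVec, dotProduct, Finset.mul_sum]
      exact Finset.sum_congr rfl fun j _ => by ring
    simp only [h2]
    simp only [metricAt, lowerIndex, Finset.sum_mul]
    exact Finset.sum_congr rfl fun i _ => Finset.sum_congr rfl fun j _ => by ring
  set R := scalarCurvature g x with hR
  have hR' : R - 2 * R = -(ρ + p) + 4 * p := by
    have e0 : ∑ μ, ∑ ν, (g x)⁻¹ μ ν * ricci g μ ν x = R := rfl
    have e1 : ∑ μ, ∑ ν, (g x)⁻¹ μ ν * einsteinTensor g μ ν x = R - R / 2 * 4 := by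
      rw [← htr, Finset.mul_sum]
      simp only [einsteinTensor, ← hR, mul_sub, Finset.sum_sub_distrib, Finset.mul_sum, e0]
      congr 1
      exact Finset.sum_congr rfl fun i _ => Finset.sum_congr rfl fun j _ => by ring
    have e2 : ∑ μ, ∑ ν, (g x)⁻¹ μ ν * einsteinTensor g μ ν x = (ρ + p) * (-1) + p * 4 := by
      rw [← htr, ← huu]
      simp only [hG, Finset.mul_sum, ← Finset.sum_add_distrib]
      exact Finset.sum_congr rfl fun i _ => Finset.sum_congr rfl fun j _ => by ring
    linarith
  have := hG μ ν
  rw [einsteinTensor, ← hR] at this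
  have hR2 : R = ρ - 3 * p := by linarith
  rw [hR2] at this
  linarith

/-! ### Locality and evaluation of the Ricci tensor -/

theorem christoffel_congr {g g' : MetricField} {x : Fin 4 → ℝ} (h : g =ᶠ[nhds x] g')
    (l μ ν : Fin 4) : christoffel g l μ ν x = christoffel g' l μ ν x := by
  have hp : ∀ i a b, partialD i (fun y => g y a b) x = partialD i (fun y => g' y a b) x :=
    fun i a b => partialD_congr (h.mono fun y hy => by simp only [hy]) i
  simp only [christoffel, hp, h.eq_of_nhds]

theorem ricci_congr {g g' : MetricField} {x : Fin 4 → ℝ} (h : g =ᶠ[nhds x] g')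
    (μ ν : Fin 4) : ricci g μ ν x = ricci g' μ ν x := by
  have hc : ∀ l a b, christoffel g l a b =ᶠ[nhds x] christoffel g' l a b := fun l a b =>
    h.eventually_nhds.mono fun y hy => christoffel_congr hy l a b
  have hp : ∀ i l a b, partialD i (christoffel g l a b) x = partialD i (christoffel g' l a b) x :=
    fun i l a b => partialD_congr (hc l a b) i
  simp only [ricci, hp, fun l a b => (hc l a b).eq_of_nhds]

theorem ricci_eq_of_christoffel {g : MetricField} {x : Fin 4 → ℝ}
    (G : Fin 4 → Fin 4 → Fin 4 → (Fin 4 → ℝ) → ℝ)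
    (hG : ∀ᶠ y in nhds x, ∀ l μ ν, christoffel g l μ ν y = G l μ ν y) {μ ν : Fin 4}
    {P Q : Fin 4 → ℝ} (hP : ∀ l, partialD l (G l μ ν) x = P l)
    (hQ : ∀ l, partialD ν (G l μ l) x = Q l) :
    ricci g μ ν x = ∑ l, (P l - Q l + ∑ κ, (G l l κ x * G κ μ ν x - G l ν κ x * G κ μ l x)) := by
  have hp : ∀ i l a b, partialD i (christoffel g l a b) x = partialD i (G l a b) x :=
    fun i l a b => partialD_congr (hG.mono fun y hy => hy l a b) i
  simp only [ricci, hp, hP, hQ, hG.self_of_nhds]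

/-! ### The curvature of warped metrics -/

/-- The metric `-dt² + W(t) ((dr - ε r dz)² + S(r)² dφ²) + A dz²` in the coordinates
`(t, r, φ, z)`. -/
noncomputable def warpedMetric (ε A : ℝ) (W S : ℝ → ℝ) : MetricField := fun x =>
  !![-1, 0, 0, 0;
     0, W (x 0), 0, -(ε * x 1 * W (x 0));
     0, 0, W (x 0) * S (x 1) ^ 2, 0;
     0, -(ε * x 1 * W (x 0)), 0, A + W (x 0) * (ε * x 1) ^ 2]

/-- The Christoffel symbols `Γ^l_{μν}` of `warpedMetric` as functions of `r` and of the values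
`w`, `w'`, `s`, `s'` of `W`, `S` and of their derivatives. -/
noncomputable def warpedGamma (ε A r w w' s s' : ℝ) : Fin 4 → Matrix (Fin 4) (Fin 4) ℝ :=
  ![!![0, 0, 0, 0;
       0, w' / 2, 0, -(ε * r * w' / 2);
       0, 0, w' * s ^ 2 / 2, 0;
       0, -(ε * r * w' / 2), 0, ε ^ 2 * r ^ 2 * w' / 2],
    !![0, w' / (2 * w), 0, -(ε * r * (w' / (2 * w)));
       w' / (2 * w), -(ε ^ 2 * r * w / A), 0, ε ^ 3 * r ^ 2 * w / A;
       0, 0, -(s * s') - ε ^ 2 * r ^ 2 * w * s * s' / A, 0;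
       -(ε * r * (w' / (2 * w))), ε ^ 3 * r ^ 2 * w / A, 0,
         -(ε ^ 2 * r) - ε ^ 4 * r ^ 3 * w / A],
    !![0, 0, w' / (2 * w), 0;
       0, 0, s' / s, 0;
       w' / (2 * w), s' / s, 0, 0;
       0, 0, 0, 0],
    !![0, 0, 0, 0;
       0, -(ε * w / A), 0, ε ^ 2 * r * w / A;
       0, 0, -(ε * r * w * s * s' / A), 0;
       0, ε ^ 2 * r * w / A, 0, -(ε ^ 3 * r ^ 2 * w / A)]]

theorem inv_warpedMetric {ε A : ℝ} {W S : ℝ → ℝ} {x : Fin 4 → ℝ} (hA : A ≠ 0)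
    (hW : W (x 0) ≠ 0) (hS : S (x 1) ≠ 0) :
    (warpedMetric ε A W S x)⁻¹ =
      !![-1, 0, 0, 0;
         0, 1 / W (x 0) + (ε * x 1) ^ 2 / A, 0, ε * x 1 / A;
         0, 0, 1 / (W (x 0) * S (x 1) ^ 2), 0;
         0, ε * x 1 / A, 0, 1 / A] := by
  refine Matrix.inv_eq_right_inv ?_
  ext i j
  fin_cases i <;> fin_cases j <;>
    simp [warpedMetric, Matrix.mul_apply, Fin.sum_univ_four] <;> field_simp <;> ring

theorem partialD_warpedMetric {ε A : ℝ} {W S : ℝ → ℝ} {x : Fin 4 → ℝ} {w' s' : ℝ}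
    (hW : HasDerivAt W w' (x 0)) (hS : HasDerivAt S s' (x 1)) (κ μ ν : Fin 4) :
    partialD κ (fun y => warpedMetric ε A W S y μ ν) x =
      (![!![0, 0, 0, 0;
           0, w', 0, -(ε * x 1 * w');
           0, 0, w' * S (x 1) ^ 2, 0;
           0, -(ε * x 1 * w'), 0, w' * (ε * x 1) ^ 2],
         !![0, 0, 0, 0;
           0, 0, 0, -(ε * W (x 0));
           0, 0, 2 * W (x 0) * S (x 1) * s', 0;
           0, -(ε * W (x 0)), 0, 2 * W (x 0) * ε ^ 2 * x 1],
         !![0, 0, 0, 0; 0, 0, 0, 0; 0, 0, 0, 0; 0, 0, 0, 0],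
         !![0, 0, 0, 0; 0, 0, 0, 0; 0, 0, 0, 0; 0, 0, 0, 0]] :
        Fin 4 → Matrix (Fin 4) (Fin 4) ℝ) κ μ ν := by
  have e1 : deriv (fun r => S r ^ 2) (x 1) = 2 * S (x 1) * s' := by
    simpa using (hS.fun_pow 2).deriv
  have e2 : deriv (fun r => (ε * r) ^ 2) (x 1) = 2 * ε ^ 2 * x 1 := by
    have := (((hasDerivAt_id (x 1)).const_mul ε).fun_pow 2).deriv
    simp only [id_eq, Nat.cast_ofNat, Nat.add_one_sub_one, pow_one, mul_one] at this
    rw [this]; ring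
  have e3 : deriv (fun r => ε * r * W (x 0)) (x 1) = ε * W (x 0) := by
    simp
  fin_cases κ <;> fin_cases μ <;> fin_cases ν <;>
    simp [warpedMetric, partialD, hW.deriv, e1, e2, e3] <;> ring

theorem christoffel_warpedMetric {ε A : ℝ} {W S : ℝ → ℝ} {x : Fin 4 → ℝ} {w' s' : ℝ}
    (hA : A ≠ 0) (hW0 : W (x 0) ≠ 0) (hS0 : S (x 1) ≠ 0)
    (hW : HasDerivAt W w' (x 0)) (hS : HasDerivAt S s' (x 1)) (l μ ν : Fin 4) :
    christoffel (warpedMetric ε A W S) l μ ν x =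
      warpedGamma ε A (x 1) (W (x 0)) w' (S (x 1)) s' l μ ν := by
  rw [christoffel, inv_warpedMetric hA hW0 hS0]
  simp only [partialD_warpedMetric hW hS, Fin.sum_univ_four]
  fin_cases l <;> fin_cases μ <;> fin_cases ν <;>
    simp [warpedGamma] <;> field_simp <;> ring

theorem eventually_christoffel_warpedMetric {ε A : ℝ} {W W' S S' : ℝ → ℝ} {x : Fin 4 → ℝ}
    (hA : A ≠ 0) (hW : ∀ᶠ t in nhds (x 0), W t ≠ 0 ∧ HasDerivAt W (W' t) t)
    (hS : ∀ᶠ r in nhds (x 1), S r ≠ 0 ∧ HasDerivAt S (S' r) r) :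
    ∀ᶠ y in nhds x, ∀ l μ ν, christoffel (warpedMetric ε A W S) l μ ν y =
      warpedGamma ε A (y 1) (W (y 0)) (W' (y 0)) (S (y 1)) (S' (y 1)) l μ ν := by
  have h0 : Filter.Tendsto (fun y : Fin 4 → ℝ => y 0) (nhds x) (nhds (x 0)) :=
    (continuous_apply 0).tendsto x
  have h1 : Filter.Tendsto (fun y : Fin 4 → ℝ => y 1) (nhds x) (nhds (x 1)) :=
    (continuous_apply 1).tendsto x
  filter_upwards [h0.eventually hW, h1.eventually hS] with y hy0 hy1 l μ ν
  exact christoffel_warpedMetric hA hy0.1 hy1.1 hy0.2 hy1.2 l μ ν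

theorem ricci_warpedMetric_zero {A k w'' : ℝ} {W W' S S' : ℝ → ℝ} {x : Fin 4 → ℝ}
    (hA : A ≠ 0) (hW : ∀ᶠ t in nhds (x 0), W t ≠ 0 ∧ HasDerivAt W (W' t) t)
    (hS : ∀ᶠ r in nhds (x 1), S r ≠ 0 ∧ HasDerivAt S (S' r) r)
    (hW' : HasDerivAt W' w'' (x 0)) (hS' : HasDerivAt S' (-k * S (x 1)) (x 1)) (μ ν : Fin 4) :
    ricci (warpedMetric 0 A W S) μ ν x =
      !![-w'' / W (x 0) + W' (x 0) ^ 2 / (2 * W (x 0) ^ 2), 0, 0, 0;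
         0, w'' / 2 + k, 0, 0;
         0, 0, (w'' / 2 + k) * S (x 1) ^ 2, 0;
         0, 0, 0, 0] μ ν := by
  have hG : ∀ᶠ y in nhds x, ∀ l μ ν, christoffel (warpedMetric 0 A W S) l μ ν y =
      (![!![0, 0, 0, 0;
            0, W' (y 0) / 2, 0, 0;
            0, 0, W' (y 0) * S (y 1) ^ 2 / 2, 0;
            0, 0, 0, 0],
         !![0, W' (y 0) / (2 * W (y 0)), 0, 0;
            W' (y 0) / (2 * W (y 0)), 0, 0, 0;
            0, 0, -(S (y 1) * S' (y 1)), 0;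
            0, 0, 0, 0],
         !![0, 0, W' (y 0) / (2 * W (y 0)), 0;
            0, 0, S' (y 1) / S (y 1), 0;
            W' (y 0) / (2 * W (y 0)), S' (y 1) / S (y 1), 0, 0;
            0, 0, 0, 0],
         !![0, 0, 0, 0; 0, 0, 0, 0; 0, 0, 0, 0; 0, 0, 0, 0]] :
        Fin 4 → Matrix (Fin 4) (Fin 4) ℝ) l μ ν := by
    filter_upwards [eventually_christoffel_warpedMetric (ε := 0) hA hW hS] with y hy l μ ν
    rw [hy]
    fin_cases l <;> fin_cases μ <;> fin_cases ν <;> simp [warpedGamma]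
  have hw := hW.self_of_nhds
  have hs := hS.self_of_nhds
  have w0 := hw.1
  have s0 := hs.1
  have e1 : deriv (fun t => W' t / (2 * W t)) (x 0) =
      w'' / (2 * W (x 0)) - W' (x 0) ^ 2 / (2 * W (x 0) ^ 2) := by
    have := (hW'.fun_div (hw.2.const_mul 2) (by simpa using w0)).deriv
    rw [this]
    field_simp
  have e2 : deriv (fun r => S' r / S r) (x 1) = -k - S' (x 1) ^ 2 / S (x 1) ^ 2 := by
    rw [(hS'.fun_div hs.2 s0).deriv]
    field_simp
  have e3 : deriv (fun r => S r * S' r) (x 1) = S' (x 1) ^ 2 - k * S (x 1) ^ 2 := by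
    rw [(hs.2.fun_mul hS').deriv]
    ring
  rw [ricci_eq_of_christoffel _ hG (fun l => rfl) (fun l => rfl)]
  simp only [Fin.sum_univ_four]
  fin_cases μ <;> fin_cases ν <;>
    simp [partialD, hW'.deriv, e1, e2, e3] <;> field_simp <;> ring

/-- For `ε = 1` the Ricci tensor is negative along the vector `∂_z + r ∂_r` if the
coefficient of `dz²` is constant. -/
theorem ricci_warpedMetric_one {A w'' : ℝ} {W W' : ℝ → ℝ} {x : Fin 4 → ℝ}
    (hA : A ≠ 0) (hW : ∀ᶠ t in nhds (x 0), W t ≠ 0 ∧ HasDerivAt W (W' t) t)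
    (hW' : HasDerivAt W' w'' (x 0)) (hx : x 1 ≠ 0) :
    ricci (warpedMetric 1 A W id) 3 3 x + 2 * x 1 * ricci (warpedMetric 1 A W id) 1 3 x
      + x 1 ^ 2 * ricci (warpedMetric 1 A W id) 1 1 x = -2 := by
  have hS : ∀ᶠ r in nhds (x 1), id r ≠ 0 ∧ HasDerivAt id ((fun _ => (1 : ℝ)) r) r := by
    filter_upwards [isOpen_ne.mem_nhds hx] with r hr
    exact ⟨hr, hasDerivAt_id r⟩
  have hG := eventually_christoffel_warpedMetric (ε := 1) hA hW hS
  have hw := hW.self_of_nhds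
  have w0 := hw.1
  have e0 : deriv (fun t => -(x 1 * W' t / 2)) (x 0) = -(x 1 * w'' / 2) :=
    (((hW'.const_mul (x 1)).div_const 2).fun_neg).deriv
  have e1 : deriv (fun t => x 1 ^ 2 * W' t / 2) (x 0) = x 1 ^ 2 * w'' / 2 :=
    ((hW'.const_mul (x 1 ^ 2)).div_const 2).deriv
  have e2 : deriv (fun r => r ^ 2 * W (x 0) / A) (x 1) = 2 * x 1 * W (x 0) / A := by
    simp
  have e3 : deriv (fun r => -r - r ^ 3 * W (x 0) / A) (x 1) =
      -1 - 3 * x 1 ^ 2 * W (x 0) / A := by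
    simpa using ((hasDerivAt_id (x 1)).fun_neg.fun_sub
      (((hasDerivAt_pow 3 (x 1)).mul_const (W (x 0))).div_const A)).deriv
  rw [ricci_eq_of_christoffel _ hG (fun l => rfl) (fun l => rfl),
    ricci_eq_of_christoffel _ hG (fun l => rfl) (fun l => rfl),
    ricci_eq_of_christoffel _ hG (fun l => rfl) (fun l => rfl)]
  simp only [Fin.sum_univ_four]
  simp [warpedGamma, partialD, hW'.deriv, e0, e1, e2, e3]
  field_simp
  ring

/-! ### The stiff fluids among the spacetimes with constant `a` -/

theorem ContDiffOn.hasDerivAt_deriv_deriv {f : ℝ → ℝ} {I : Set ℝ} (hf : ContDiffOn ℝ 2 f I)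
    (hI : IsOpen I) {t : ℝ} (ht : t ∈ I) :
    HasDerivAt f (deriv f t) t ∧ HasDerivAt (deriv f) (deriv (deriv f) t) t := by
  refine ⟨((hf.contDiffAt (hI.mem_nhds ht)).differentiableAt (by norm_num)).hasDerivAt, ?_⟩
  have h1 : ContDiffOn ℝ 1 (deriv f) I := hf.deriv_of_isOpen hI (by norm_num)
  exact ((h1.contDiffAt (hI.mem_nhds ht)).differentiableAt (by norm_num)).hasDerivAt

namespace LRSSpacetime

variable {M : LRSSpacetime}

theorem contDiffOn_b_sq : ContDiffOn ℝ 2 (fun t => M.b t ^ 2) M.I := M.contDiffOn_b.pow 2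

theorem metric_eventuallyEq_warpedMetric (hn : M.n = 0) {x : Fin 4 → ℝ} {a₀ : ℝ}
    (ha : ∀ᶠ t in nhds (x 0), M.a t = a₀) :
    M.metric =ᶠ[nhds x] warpedMetric M.ε (a₀ ^ 2) (fun t => M.b t ^ 2) (sigmaFn M.k) := by
  have h0 : Filter.Tendsto (fun y : Fin 4 → ℝ => y 0) (nhds x) (nhds (x 0)) :=
    (continuous_apply 0).tendsto x
  filter_upwards [h0.eventually ha] with y hy
  simp [metric, warpedMetric, hn, hy]

theorem eventually_sq_b (M : LRSSpacetime) {t₀ : ℝ} (ht : t₀ ∈ M.I) :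
    ∀ᶠ t in nhds t₀, M.b t ^ 2 ≠ 0 ∧
      HasDerivAt (fun t => M.b t ^ 2) (deriv (fun t => M.b t ^ 2) t) t := by
  filter_upwards [M.isOpen_I.mem_nhds ht] with t ht
  exact ⟨pow_ne_zero 2 (M.b_pos t ht).ne', (contDiffOn_b_sq.hasDerivAt_deriv_deriv M.isOpen_I ht).1⟩

theorem eventually_sigmaFn {x : Fin 4 → ℝ} (hx : x ∈ M.domain) :
    ∀ᶠ r in nhds (x 1), sigmaFn M.k r ≠ 0 ∧
      HasDerivAt (sigmaFn M.k) (sigmaDeriv M.k r) r := by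
  have hc := (hasDerivAt_sigmaFn M.k (x 1)).continuousAt
  filter_upwards [hc.eventually_ne (sigma_pos hx).ne'] with r hr
  exact ⟨hr, hasDerivAt_sigmaFn M.k r⟩

/-- If `a` is constant, a perfect fluid obeying the dominant energy condition has `ε = 0`: the
Ricci tensor cannot be negative along the spacelike vector `∂_z + ε r ∂_r`. -/
theorem epsilon_eq_zero (hn : M.n = 0) {x u : Fin 4 → ℝ} {ρ p a₀ : ℝ} (hx : x ∈ M.domain)
    (ha : ∀ᶠ t in nhds (x 0), M.a t = a₀) (hf : IsPerfectFluidAt M.metric x ρ p u)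
    (hd : DominantEnergy ρ p) : M.ε = 0 := by
  rcases M.ε_eq with hε | hε
  · exact hε
  exfalso
  have hk : M.k = 0 := by
    have := M.ε_mul_k
    rw [hε, one_mul] at this
    exact_mod_cast this
  have hS : sigmaFn M.k = id := by
    funext r
    simp [sigmaFn, hk]
  have hg := metric_eventuallyEq_warpedMetric hn ha
  have ha0 : a₀ ≠ 0 := ha.self_of_nhds ▸ (M.a_pos _ hx.1).ne'
  have hR := ricci_warpedMetric_one (A := a₀ ^ 2) (pow_ne_zero 2 ha0) (M.eventually_sq_b hx.1)
    (contDiffOn_b_sq.hasDerivAt_deriv_deriv M.isOpen_I hx.1).2 hx.2.1.ne'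
  rw [← hS, ← hε, ← ricci_congr hg, ← ricci_congr hg, ← ricci_congr hg] at hR
  simp only [hf.ricci_eq (M.isSymm_metric x) (isUnit_det_metric hx)] at hR
  set u1 := lowerIndex M.metric x u 1
  set u3 := lowerIndex M.metric x u 3
  have g33 : M.metric x 3 3 = M.a (x 0) ^ 2 + M.b (x 0) ^ 2 * x 1 ^ 2 := by simp [metric, hε]
  have g13 : M.metric x 1 3 = -(x 1 * M.b (x 0) ^ 2) := by simp [metric, hε]
  have g11 : M.metric x 1 1 = M.b (x 0) ^ 2 := by simp [metric]
  rw [g33, g13, g11] at hR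
  obtain ⟨h1, h2⟩ := abs_le.1 hd
  have p1 : 0 ≤ (ρ + p) * (u3 + x 1 * u1) ^ 2 := mul_nonneg (by linarith) (sq_nonneg _)
  have p2 : 0 ≤ (ρ - p) / 2 * M.a (x 0) ^ 2 := mul_nonneg (by linarith) (sq_nonneg _)
  linarith

/-- If `a` is constant and `ε = n = 0`, a perfect fluid obeying the dominant energy condition is
stiff, and Einstein's equations reduce to `(b²)'' = -2 k`. -/
theorem stiff_of_perfectFluid (hn : M.n = 0) (hε : M.ε = 0) {x u : Fin 4 → ℝ} {ρ p a₀ : ℝ}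
    (hx : x ∈ M.domain) (ha : ∀ᶠ t in nhds (x 0), M.a t = a₀)
    (hf : IsPerfectFluidAt M.metric x ρ p u) (hd : DominantEnergy ρ p) :
    ρ = p ∧ 0 < ρ ∧ deriv (deriv fun t => M.b t ^ 2) (x 0) = -2 * (M.k : ℝ) ∧
      4 * (M.k : ℝ) * M.b (x 0) ^ 2 + deriv (fun t => M.b t ^ 2) (x 0) ^ 2 =
        4 * (M.b (x 0) ^ 2) ^ 2 * ρ := by
  have hg := metric_eventuallyEq_warpedMetric hn ha
  have ha0 : a₀ ≠ 0 := ha.self_of_nhds ▸ (M.a_pos _ hx.1).ne'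
  have hR := ricci_warpedMetric_zero (A := a₀ ^ 2) (k := M.k) (pow_ne_zero 2 ha0)
    (M.eventually_sq_b hx.1) (eventually_sigmaFn hx)
    (contDiffOn_b_sq.hasDerivAt_deriv_deriv M.isOpen_I hx.1).2
    (hasDerivAt_sigmaDeriv M.k_eq (x 1))
  rw [hε] at hg
  simp only [← ricci_congr hg, hf.ricci_eq (M.isSymm_metric x) (isUnit_det_metric hx)] at hR
  obtain ⟨h1, h2⟩ := abs_le.1 hd
  have hpos : 0 < ρ + p := lt_of_le_of_ne (by linarith) hf.2.1.symm
  have hl0 : lowerIndex M.metric x u 0 = -u 0 := by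
    simp [lowerIndex, metric, Fin.sum_univ_four]
  have hu0 : u 0 ≠ 0 := by
    intro h0
    have h := eq_zero_of_metricAt_self_nonpos hx h0 (by rw [hf.1]; norm_num)
    have := hf.1
    rw [h] at this
    simp [metricAt] at this
  have hnorm : lowerIndex M.metric x u 0 * u 0 + lowerIndex M.metric x u 1 * u 1
      + lowerIndex M.metric x u 2 * u 2 + lowerIndex M.metric x u 3 * u 3 = -1 := by
    rw [← hf.1]
    simp only [lowerIndex, metricAt, Fin.sum_univ_four]
    ring
  have hb := M.b_pos _ hx.1
  have r33 := hR 3 3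
  have r01 := hR 0 1
  have r02 := hR 0 2
  have r11 := hR 1 1
  have r00 := hR 0 0
  rw [hl0] at r01 r02 r00 hnorm
  have g33 : M.metric x 3 3 = M.a (x 0) ^ 2 := by simp [metric, hε]
  have g01 : M.metric x 0 1 = 0 := by simp [metric]
  have g02 : M.metric x 0 2 = 0 := by simp [metric]
  have g11 : M.metric x 1 1 = M.b (x 0) ^ 2 := by simp [metric]
  have g00 : M.metric x 0 0 = -1 := by simp [metric]
  rw [g33] at r33
  rw [g01] at r01
  rw [g02] at r02
  rw [g11] at r11
  rw [g00] at r00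
  simp only [Matrix.of_apply, Matrix.cons_val', Matrix.cons_val_zero, Matrix.cons_val_one,
    Matrix.cons_val, mul_zero, add_zero] at r33 r01 r02 r11 r00
  have q1 : 0 ≤ (ρ + p) * lowerIndex M.metric x u 3 ^ 2 := mul_nonneg hpos.le (sq_nonneg _)
  have q2 : 0 ≤ (ρ - p) / 2 * M.a (x 0) ^ 2 := mul_nonneg (by linarith) (sq_nonneg _)
  have e2 : (ρ - p) / 2 * M.a (x 0) ^ 2 = 0 := by linarith
  have e1 : (ρ + p) * lowerIndex M.metric x u 3 ^ 2 = 0 := by linarith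
  have hρp : ρ = p := by
    have := (M.a_pos _ hx.1).ne'
    have : (ρ - p) / 2 = 0 := by simpa [this] using e2
    linarith
  have l3 : lowerIndex M.metric x u 3 = 0 := by simpa [hpos.ne'] using e1
  have l1 : lowerIndex M.metric x u 1 = 0 := by simpa [hpos.ne', hu0] using r01
  have l2 : lowerIndex M.metric x u 2 = 0 := by simpa [hpos.ne', hu0] using r02
  rw [l1, l2, l3] at hnorm
  rw [l1, ← hρp] at r11
  have hu1 : u 0 * u 0 = 1 := by linarith
  have hW'' : deriv (deriv fun t => M.b t ^ 2) (x 0) = -2 * (M.k : ℝ) := by linarith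
  refine ⟨hρp, by linarith, hW'', ?_⟩
  rw [hW'', ← hρp] at r00
  have r00' : 2 * ρ * (u 0 * u 0) = -(-2 * (M.k : ℝ)) / M.b (x 0) ^ 2
      + deriv (fun t => M.b t ^ 2) (x 0) ^ 2 / (2 * (M.b (x 0) ^ 2) ^ 2) := by
    rw [← r00]; ring
  rw [hu1] at r00'
  field_simp at r00'
  linarith

end LRSSpacetime

/-- The positive solutions of `W'' = -2 k` with positive first integral `4 k W + W'²` are
`W = α s - k s²`, where `s = ± (t - t₀)`. -/
theorem exists_eq_quadratic {J : Set ℝ} (hJo : IsOpen J) (hJc : IsPreconnected J)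
    (hJn : J.Nonempty) {k : ℤ} (hk : k = 1 ∨ k = 0 ∨ k = -1) {W W' : ℝ → ℝ}
    (hpos : ∀ t ∈ J, 0 < W t) (hW : ∀ t ∈ J, HasDerivAt W (W' t) t)
    (hW' : ∀ t ∈ J, HasDerivAt W' (-2 * (k : ℝ)) t)
    (hα : ∀ t ∈ J, 0 < 4 * (k : ℝ) * W t + W' t ^ 2) :
    ∃ α t₀ τ : ℝ, 0 < α ∧ (τ = 1 ∨ τ = -1) ∧ ∀ t ∈ J, τ * (t - t₀) ∈ stiffTime k α ∧
      W t = α * (τ * (t - t₀)) - k * (τ * (t - t₀)) ^ 2 ∧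
      α ^ 2 = 4 * (k : ℝ) * W t + W' t ^ 2 := by
  obtain ⟨t₁, ht₁⟩ := hJn
  have hconst : ∀ f : ℝ → ℝ, (∀ t ∈ J, HasDerivAt f 0 t) → ∀ t ∈ J, f t = f t₁ :=
    fun f hf t ht => hJo.is_const_of_deriv_eq_zero hJc
      (fun s hs => (hf s hs).differentiableAt.differentiableWithinAt)
      (fun s hs => (hf s hs).deriv) ht ht₁
  set D := 4 * (k : ℝ) * W t₁ + W' t₁ ^ 2 with hD
  have c1 : ∀ t ∈ J, 4 * (k : ℝ) * W t + W' t ^ 2 = D := by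
    refine hconst (fun t => 4 * (k : ℝ) * W t + W' t ^ 2) fun t ht => ?_
    refine (((hW t ht).const_mul (4 * (k : ℝ))).fun_add ((hW' t ht).fun_pow 2)).congr_deriv ?_
    simp only [Nat.cast_ofNat, Nat.add_one_sub_one, pow_one]
    ring
  have c2 : ∀ t ∈ J, W' t + 2 * (k : ℝ) * t = W' t₁ + 2 * (k : ℝ) * t₁ := by
    refine hconst (fun t => W' t + 2 * (k : ℝ) * t) fun t ht => ?_
    refine ((hW' t ht).fun_add ((hasDerivAt_id t).const_mul (2 * (k : ℝ)))).congr_deriv ?_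
    ring
  have hD0 : 0 < D := hα t₁ ht₁
  set α := √D with hαd
  have hα0 : 0 < α := Real.sqrt_pos.2 hD0
  have hα2 : α ^ 2 = D := Real.sq_sqrt hD0.le
  obtain ⟨τ, hτ, hτ1⟩ : ∃ τ : ℝ, (τ = 1 ∨ τ = -1) ∧ 0 ≤ τ * W' t₁ := by
    rcases le_total 0 (W' t₁) with h | h
    · exact ⟨1, Or.inl rfl, by linarith⟩
    · exact ⟨-1, Or.inr rfl, by linarith⟩
  have hττ : τ * τ = 1 := by rcases hτ with rfl | rfl <;> norm_num
  rcases eq_or_ne k 0 with hk0 | hk0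
  · subst hk0
    simp only [Int.cast_zero, mul_zero, zero_mul, zero_add, add_zero] at c1 c2 hD
    have hW1 : W' t₁ = τ * α := by
      have h : τ * W' t₁ = α := by
        rw [← abs_of_nonneg hτ1, hαd, hD, Real.sqrt_sq_eq_abs, abs_mul]
        rcases hτ with rfl | rfl <;> simp
      rw [← h, ← mul_assoc, hττ, one_mul]
    have c3 : ∀ t ∈ J, W t - τ * α * t = W t₁ - τ * α * t₁ := by
      refine hconst (fun t => W t - τ * α * t) fun t ht => ?_
      refine ((hW t ht).fun_sub ((hasDerivAt_id t).const_mul (τ * α))).congr_deriv ?_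
      rw [c2 t ht, hW1]
      ring
    refine ⟨α, t₁ - τ * (W t₁ / α), τ, hα0, hτ, fun t ht => ?_⟩
    have hWt : W t = α * (τ * (t - (t₁ - τ * (W t₁ / α)))) := by
      have e : α * (τ * (t - (t₁ - τ * (W t₁ / α)))) =
          τ * α * (t - t₁) + τ * τ * (α * (W t₁ / α)) := by ring
      rw [e, hττ, mul_div_cancel₀ _ hα0.ne']
      linarith [c3 t ht]
    refine ⟨⟨?_, by simpa using hα0⟩, ?_, ?_⟩
    · have := hpos t ht
      rw [hWt] at this
      exact (mul_pos_iff_of_pos_left hα0).1 this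
    · rw [Int.cast_zero, zero_mul, sub_zero]
      exact hWt
    · rw [hα2, ← c1 t ht]
      simp
  · have hkR : (k : ℝ) ≠ 0 := by exact_mod_cast hk0
    set s₁ := (α - τ * W' t₁) / (2 * (k : ℝ)) with hs₁
    have hs₁' : 2 * (k : ℝ) * s₁ = α - τ * W' t₁ := by
      rw [hs₁]
      field_simp
    refine ⟨α, t₁ - τ * s₁, τ, hα0, hτ, fun t ht => ?_⟩
    set s := τ * (t - (t₁ - τ * s₁)) with hs
    have hs' : s = τ * (t - t₁) + s₁ := by
      have : s = τ * (t - t₁) + τ * τ * s₁ := by rw [hs]; ring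
      rw [this, hττ, one_mul]
    have hτW : τ * W' t = α - 2 * k * s := by
      have : W' t = W' t₁ - 2 * k * (t - t₁) := by linarith [c2 t ht]
      rw [this, hs']
      linarith
    have hWW : W' t ^ 2 = (α - 2 * k * s) ^ 2 := by
      rw [← hτW, mul_pow, pow_two τ, hττ, one_mul]
    have hWt : W t = α * s - k * s ^ 2 := by
      have h := c1 t ht
      rw [hWW, ← hα2] at h
      have : 4 * (k : ℝ) * W t = 4 * k * (α * s - k * s ^ 2) := by linarith
      exact mul_left_cancel₀ (mul_ne_zero four_ne_zero hkR) this
    have hWp := hpos t ht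
    rw [hWt] at hWp
    refine ⟨?_, hWt, by rw [hα2, c1 t ht]⟩
    have hs0 : 0 < s := by
      rcases hk with rfl | rfl | rfl
      · by_contra! hneg
        simp only [Int.cast_one, one_mul] at hWp
        nlinarith [sq_nonneg s]
      · exact absurd rfl hk0
      · -- for `k = -1` the derivative has no zero, hence keeps its sign on the interval
        by_contra! hneg
        simp only [Int.cast_neg, Int.cast_one, neg_mul, one_mul, mul_neg, sub_neg_eq_add]
          at hWp hτW c1 hD
        have hlt : τ * W' t ≤ 0 := by
          rw [hτW]
          nlinarith
        have hcont : ContinuousOn (fun t => τ * W' t) J := fun y hy =>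
          ((hW' y hy).continuousAt.const_smul τ).continuousWithinAt
        obtain ⟨y, hy, hy0⟩ := hJc.intermediate_value ht ht₁ hcont ⟨hlt, hτ1⟩
        have hy1 : W' y = 0 := by
          rcases mul_eq_zero.1 hy0 with h | h
          · rw [h] at hττ
            norm_num at hττ
          · exact h
        have := c1 y hy
        rw [hy1] at this
        have := hpos y hy
        linarith
    refine ⟨hs0, ?_⟩
    have : 0 < s * (α - k * s) := by linarith
    exact (mul_pos_iff_of_pos_left hs0).1 this

theorem pullbackMetric_stiffMetric (k : ℤ) (α τ t₀ β : ℝ) (hτ : τ = 1 ∨ τ = -1)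
    (x : Fin 4 → ℝ) :
    pullbackMetric (normalizeCoord τ t₀ β) (stiffMetric k α) x =
      Matrix.diagonal ![-1, α * (τ * (x 0 - t₀)) - k * (τ * (x 0 - t₀)) ^ 2,
        (α * (τ * (x 0 - t₀)) - k * (τ * (x 0 - t₀)) ^ 2) * sigmaFn k (x 1) ^ 2, β ^ 2] := by
  have hττ : τ * τ = 1 := by rcases hτ with rfl | rfl <;> norm_num
  ext i j
  simp only [pullbackMetric, stiffMetric, Matrix.of_apply, Matrix.diagonal_apply, ite_mul,
    zero_mul, Finset.sum_ite_eq, Finset.mem_univ, if_true, Fin.sum_univ_four]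
  fin_cases i <;> fin_cases j <;> simp [normalizeCoord, partialD, hττ, pow_two]

/-- The LRS side of a matching is a stiff fluid on the time range of the hypersurface.  Since `n = 1`
would make both `a` and `b` stationary there, this is where non-staticity enters. -/
theorem exists_stiffMetric_of_matching (M : LRSSpacetime) (N : StaticCylindrical)
    (σ : Matching M.metric M.domain N.metric N.domain)
    (ρ p : (Fin 4 → ℝ) → ℝ) (u : (Fin 4 → ℝ) → (Fin 4 → ℝ))
    (hσ : σ.NonSpacelike) (hsym : PreservesCylindricalSymmetry M N σ)
    (hns : M.NonStaticOn σ.timeRange)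
    (hfl : ∀ x ∈ M.domain, IsPerfectFluidAt M.metric x (ρ x) (p x) (u x))
    (hde : ∀ x ∈ M.domain, DominantEnergy (ρ x) (p x)) :
    ∃ α β t₀ τ : ℝ, 0 < α ∧ 0 < β ∧ (τ = 1 ∨ τ = -1) ∧
      ∀ x ∈ M.domain, x 0 ∈ σ.timeRange →
        τ * (x 0 - t₀) ∈ stiffTime M.k α ∧
        M.metric x = pullbackMetric (normalizeCoord τ t₀ β) (stiffMetric M.k α) x ∧
        ρ x = p x ∧
        ρ x = stiffDensity M.k α (τ * (x 0 - t₀)) := by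
  have hJo : IsOpen σ.timeRange := isOpen_timeRange hσ
  have hJc : IsPreconnected σ.timeRange := isPreconnected_timeRange
  have hJI : σ.timeRange ⊆ M.I := timeRange_subset
  have hJd : ∀ t ∈ σ.timeRange, deriv M.a t = 0 ∧ (M.n = 1 → deriv M.b t = 0) := by
    rintro _ ⟨ξ, hξ, rfl⟩
    exact deriv_eq_zero_of_preservesCylindricalSymmetry hsym hξ
  obtain ⟨t₁, ht₁, hne⟩ := hns
  have hn : M.n = 0 := by
    rcases M.n_eq with h | h
    · exact h
    · rcases hne with h' | h'
      · exact absurd (hJd t₁ ht₁).1 h'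
      · exact absurd ((hJd t₁ ht₁).2 h) h'
  have haJ : ∀ t ∈ σ.timeRange, M.a t = M.a t₁ := fun t ht =>
    hJo.is_const_of_deriv_eq_zero hJc
      (fun s hs => (LRSSpacetime.hasDerivAt_a (hJI hs)).differentiableAt.differentiableWithinAt)
      (fun s hs => (hJd s hs).1) ht ht₁
  have haev : ∀ t ∈ σ.timeRange, ∀ᶠ s in nhds t, M.a s = M.a t₁ := fun t ht =>
    Filter.mem_of_superset (hJo.mem_nhds ht) haJ
  have hpt : ∀ t ∈ M.I, (![t, 1, 0, 0] : Fin 4 → ℝ) ∈ M.domain := fun t ht =>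
    ⟨by simpa using ht, by simp, fun _ => by
      simpa using (by linarith [Real.pi_gt_three] : (1 : ℝ) < Real.pi)⟩
  have hε : M.ε = 0 := by
    have hx := hpt t₁ (hJI ht₁)
    exact LRSSpacetime.epsilon_eq_zero hn hx (haev _ (by simpa using ht₁)) (hfl _ hx) (hde _ hx)
  have hst : ∀ x ∈ M.domain, x 0 ∈ σ.timeRange → _ := fun x hx hxJ =>
    LRSSpacetime.stiff_of_perfectFluid hn hε hx (haev _ hxJ) (hfl x hx) (hde x hx)
  have hb0 : ∀ t ∈ M.I, 0 < M.b t ^ 2 := fun t ht => pow_pos (M.b_pos t ht) 2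
  obtain ⟨α, t₀, τ, hα, hτ, hW⟩ := exists_eq_quadratic hJo hJc ⟨t₁, ht₁⟩ M.k_eq
    (W := fun t => M.b t ^ 2) (W' := deriv fun t => M.b t ^ 2)
    (fun t ht => hb0 t (hJI ht))
    (fun t ht => (LRSSpacetime.contDiffOn_b_sq.hasDerivAt_deriv_deriv M.isOpen_I (hJI ht)).1)
    (fun t ht => by
      have h := (LRSSpacetime.contDiffOn_b_sq.hasDerivAt_deriv_deriv M.isOpen_I (hJI ht)).2
      have e := (hst _ (hpt t (hJI ht)) (by simpa using ht)).2.2.1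
      simp only [Matrix.cons_val_zero] at e
      rwa [e] at h)
    (fun t ht => by
      obtain ⟨-, hρ, -, e⟩ := hst _ (hpt t (hJI ht)) (by simpa using ht)
      simp only [Matrix.cons_val_zero] at e
      rw [e]
      have := hb0 t (hJI ht)
      positivity)
  refine ⟨α, M.a t₁, t₀, τ, hα, M.a_pos _ (hJI ht₁), hτ, fun x hx hxJ => ?_⟩
  obtain ⟨h1, h2, h3⟩ := hW _ hxJ
  obtain ⟨hρp, -, -, e⟩ := hst x hx hxJ
  refine ⟨h1, ?_, hρp, ?_⟩
  · rw [pullbackMetric_stiffMetric _ _ _ _ _ hτ, ← h2, ← haJ _ hxJ]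
    ext i j
    fin_cases i <;> fin_cases j <;> simp [LRSSpacetime.metric, hn, hε]
  · rw [← h3] at e
    have hs := h1.1
    have hs' := h1.2
    set s := τ * (x 0 - t₀)
    have h2' : M.b (x 0) ^ 2 = s * (α - M.k * s) := by
      rw [h2]
      ring
    rw [h2'] at e
    rw [stiffDensity, e]
    field_simp
    rw [eq_div_iff (by linarith)]

/-! ### The stiff fluid family is an LRS perfect fluid -/

/-- The function `α t - k t²`. -/
noncomputable def profile (k : ℤ) (α t : ℝ) : ℝ := α * t - (k : ℝ) * t ^ 2

/-- The derivative `α - 2 k t` of `profile`. -/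
noncomputable def profileDeriv (k : ℤ) (α t : ℝ) : ℝ := α - 2 * (k : ℝ) * t

theorem hasDerivAt_profile (k : ℤ) (α t : ℝ) :
    HasDerivAt (profile k α) (profileDeriv k α t) t := by
  refine (((hasDerivAt_id t).const_mul α).fun_sub
    ((hasDerivAt_pow 2 t).const_mul (k : ℝ))).congr_deriv ?_
  simp only [profileDeriv, Nat.cast_ofNat, Nat.add_one_sub_one, pow_one]
  ring

theorem hasDerivAt_profileDeriv (k : ℤ) (α t : ℝ) :
    HasDerivAt (profileDeriv k α) (-2 * (k : ℝ)) t := by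
  refine (((hasDerivAt_id t).const_mul (2 * (k : ℝ))).const_sub α).congr_deriv ?_
  ring

theorem contDiff_profile (k : ℤ) (α : ℝ) {n : WithTop ℕ∞} : ContDiff ℝ n (profile k α) := by
  unfold profile
  fun_prop

theorem profileDeriv_sq (k : ℤ) (α t : ℝ) :
    4 * (k : ℝ) * profile k α t + profileDeriv k α t ^ 2 = α ^ 2 := by
  unfold profile profileDeriv
  ring

theorem profile_pos {k : ℤ} {α t : ℝ} (ht : t ∈ stiffTime k α) : 0 < profile k α t := by
  have h : profile k α t = t * (α - k * t) := by
    unfold profile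
    ring
  rw [h]
  exact mul_pos ht.1 ht.2

theorem isOpen_stiffTime (k : ℤ) (α : ℝ) : IsOpen (stiffTime k α) :=
  (isOpen_lt continuous_const continuous_id).inter
    (isOpen_lt continuous_const (continuous_const.sub (continuous_const.mul continuous_id)))

theorem isConnected_stiffTime {k : ℤ} (hk : k = 1 ∨ k = 0 ∨ k = -1) {α : ℝ} (hα : 0 < α) :
    IsConnected (stiffTime k α) := by
  refine ⟨⟨α / 2, by linarith, ?_⟩, Convex.isPreconnected ?_⟩
  · rcases hk with rfl | rfl | rfl <;> norm_num <;> linarith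
  · have h1 : Convex ℝ {t : ℝ | (0 : ℝ) < t} := convex_Ioi 0
    have h2 : Convex ℝ {t : ℝ | (k : ℝ) * t < α} :=
      convex_halfSpace_lt (IsLinearMap.isLinearMap_smul (k : ℝ)) α
    have : stiffTime k α = {t : ℝ | (0 : ℝ) < t} ∩ {t : ℝ | (k : ℝ) * t < α} := by
      ext t
      simp [stiffTime]
    rw [this]
    exact h1.inter h2

/-- The stiff fluid metric as an LRS spacetime, with `a = 1` and `b² = α t - k t²`. -/
noncomputable def stiffLRS (k : ℤ) (hk : k = 1 ∨ k = 0 ∨ k = -1) (α : ℝ) (hα : 0 < α) :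
    LRSSpacetime where
  ε := 0
  n := 0
  k := k
  ε_eq := Or.inl rfl
  n_eq := Or.inl rfl
  k_eq := hk
  ε_mul_n := by simp
  ε_mul_k := by simp
  I := stiffTime k α
  isOpen_I := isOpen_stiffTime k α
  isConnected_I := isConnected_stiffTime hk hα
  a := fun _ => 1
  b := fun t => √(profile k α t)
  contDiffOn_a := contDiffOn_const
  contDiffOn_b := (contDiff_profile k α).contDiffOn.sqrt fun _ ht => (profile_pos ht).ne'
  a_pos := fun _ _ => one_pos
  b_pos := fun _ ht => Real.sqrt_pos.2 (profile_pos ht)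

theorem stiffLRS_metric {k : ℤ} {hk : k = 1 ∨ k = 0 ∨ k = -1} {α : ℝ} {hα : 0 < α}
    {x : Fin 4 → ℝ} (hx : x 0 ∈ stiffTime k α) :
    (stiffLRS k hk α hα).metric x = warpedMetric 0 1 (profile k α) (sigmaFn k) x := by
  have h := Real.sq_sqrt (profile_pos hx).le
  simp [LRSSpacetime.metric, stiffLRS, warpedMetric, h]

theorem stiffLRS_metric_eventuallyEq {k : ℤ} {hk : k = 1 ∨ k = 0 ∨ k = -1} {α : ℝ} {hα : 0 < α}
    {x : Fin 4 → ℝ} (hx : x 0 ∈ stiffTime k α) :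
    (stiffLRS k hk α hα).metric =ᶠ[nhds x] warpedMetric 0 1 (profile k α) (sigmaFn k) := by
  filter_upwards [((isOpen_stiffTime k α).preimage (continuous_apply 0)).mem_nhds
    (show x ∈ (fun y : Fin 4 → ℝ => y 0) ⁻¹' stiffTime k α from hx)] with y hy
  exact stiffLRS_metric hy

theorem warpedMetric_eq_stiffMetric (k : ℤ) (α : ℝ) (x : Fin 4 → ℝ) :
    warpedMetric 0 1 (profile k α) (sigmaFn k) x = stiffMetric k α x := by
  ext i j
  fin_cases i <;> fin_cases j <;> simp [warpedMetric, stiffMetric, profile]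

theorem IsPerfectFluidAt.congr {g g' : MetricField} {x u : Fin 4 → ℝ} {ρ p : ℝ}
    (h : IsPerfectFluidAt g' x ρ p u) (hg : g =ᶠ[nhds x] g') : IsPerfectFluidAt g x ρ p u := by
  have hx := hg.eq_of_nhds
  have hR := fun μ ν => ricci_congr hg μ ν
  simpa only [IsPerfectFluidAt, einsteinTensor, scalarCurvature, lowerIndex, metricAt, hx, hR]
    using h

theorem stiffDensity_eq (k : ℤ) (α t : ℝ) :
    stiffDensity k α t = α ^ 2 / (4 * profile k α t ^ 2) := by
  unfold stiffDensity profile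
  congr 1
  ring

theorem stiffDensity_pos {k : ℤ} {α t : ℝ} (hα : 0 < α) (ht : t ∈ stiffTime k α) :
    0 < stiffDensity k α t := by
  rw [stiffDensity_eq]
  have := profile_pos ht
  positivity

/-- The only nonzero component of the Ricci tensor is `R_{tt} = 2 ρ`. -/
theorem isPerfectFluidAt_stiff {k : ℤ} (hk : k = 1 ∨ k = 0 ∨ k = -1) {α : ℝ} (hα : 0 < α)
    {x : Fin 4 → ℝ} (hx : x 0 ∈ stiffTime k α) (hs : 0 < sigmaFn k (x 1)) :
    IsPerfectFluidAt (warpedMetric 0 1 (profile k α) (sigmaFn k)) x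
      (stiffDensity k α (x 0)) (stiffDensity k α (x 0)) (Pi.single 0 1) := by
  have hW := profile_pos hx
  have hd := stiffDensity_pos hα hx
  have hric := ricci_warpedMetric_zero (A := 1) (k := (k : ℝ)) (x := x) one_ne_zero
    (W := profile k α) (W' := profileDeriv k α) (S := sigmaFn k) (S' := sigmaDeriv k)
    (by
      filter_upwards [(isOpen_stiffTime k α).mem_nhds hx] with t ht
      exact ⟨(profile_pos ht).ne', hasDerivAt_profile k α t⟩)
    (by
      filter_upwards [(hasDerivAt_sigmaFn k (x 1)).continuousAt.eventually_ne hs.ne'] with r hr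
      exact ⟨hr, hasDerivAt_sigmaFn k r⟩)
    (hasDerivAt_profileDeriv k α (x 0)) (hasDerivAt_sigmaDeriv hk (x 1))
  have h00 : -(-2 * (k : ℝ)) / profile k α (x 0)
      + profileDeriv k α (x 0) ^ 2 / (2 * profile k α (x 0) ^ 2) =
      2 * stiffDensity k α (x 0) := by
    rw [stiffDensity_eq, ← profileDeriv_sq k α (x 0)]
    field_simp
    ring
  have h11 : -2 * (k : ℝ) / 2 + k = 0 := by ring
  rw [h00, h11] at hric
  refine ⟨?_, by positivity, fun μ ν => ?_⟩
  · rw [metricAt_single]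
    simp [warpedMetric]
  · have hR : scalarCurvature (warpedMetric 0 1 (profile k α) (sigmaFn k)) x =
        -(2 * stiffDensity k α (x 0)) := by
      simp only [scalarCurvature, hric, inv_warpedMetric one_ne_zero hW.ne' hs.ne',
        Fin.sum_univ_four]
      simp
    rw [einsteinTensor, hR, hric]
    fin_cases μ <;> fin_cases ν <;>
      simp [lowerIndex, warpedMetric, Pi.single_apply] <;> ring

/-! ### A static exterior for the stiff fluids -/

/-- The time interval covered by the hypersurface on which the static exterior is attached. -/
def matchTime (α : ℝ) : Set ℝ := Set.Ioo (α / 8) (α / 4)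

theorem isOpen_matchTime (α : ℝ) : IsOpen (matchTime α) := isOpen_Ioo

/-- For `Σ(r₀,k) = 1 / 2` the differential of `|∂_φ|²` on the hypersurface is spacelike if and only
if `α² / 16 < α t - k t²`, as it must be on the static side, where it is a multiple of `dρ`; the
last inequality allows `t` to serve as the coordinate `ρ`. -/
theorem matchTime_bounds {k : ℤ} (hk : k = 1 ∨ k = 0 ∨ k = -1) {α t : ℝ} (hα : 0 < α)
    (ht : t ∈ matchTime α) :
    t ∈ stiffTime k α ∧ α ^ 2 / 16 < profile k α t ∧ 0 < profileDeriv k α t := by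
  obtain ⟨h1, h2⟩ := ht
  have h0 : 0 < t := by linarith
  have hm : 0 < (t - α / 8) * (α / 4 - t) := mul_pos (by linarith) (by linarith)
  rcases hk with rfl | rfl | rfl
  · refine ⟨⟨h0, ?_⟩, ?_, ?_⟩ <;> simp [profile, profileDeriv] <;> nlinarith
  · refine ⟨⟨h0, ?_⟩, ?_, ?_⟩ <;> simp [profile, profileDeriv] <;> nlinarith
  · refine ⟨⟨h0, ?_⟩, ?_, ?_⟩ <;> simp [profile, profileDeriv] <;> nlinarith

/-- The square `1 - α² / (16 (α t - k t²))` of the norm of the static Killing vector. -/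
noncomputable def lapseSq (k : ℤ) (α t : ℝ) : ℝ := 1 - α ^ 2 / 16 / profile k α t

/-- The derivative of `lapseSq`. -/
noncomputable def lapseSqDeriv (k : ℤ) (α t : ℝ) : ℝ :=
  α ^ 2 / 16 * profileDeriv k α t / profile k α t ^ 2

/-- The radial metric coefficient `c² / lapseSq - 1`: it makes the curve with velocity
`dT/dt = c / lapseSq`, `dρ/dt = 1` a timelike geodesic parametrized by proper time. -/
noncomputable def radialSq (k : ℤ) (α c t : ℝ) : ℝ := c ^ 2 / lapseSq k α t - 1

section StaticExterior

variable {k : ℤ} (hk : k = 1 ∨ k = 0 ∨ k = -1) {α : ℝ} (hα : 0 < α) {c t : ℝ}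
include hk hα

theorem lapseSq_pos (ht : t ∈ matchTime α) : 0 < lapseSq k α t := by
  obtain ⟨h1, h2, -⟩ := matchTime_bounds hk hα ht
  rw [lapseSq, sub_pos, div_lt_one (profile_pos h1)]
  exact h2

theorem radialSq_mul_lapseSq (hc : c ^ 2 = 1 - (k : ℝ) / 4) (ht : t ∈ matchTime α) :
    radialSq k α c t * lapseSq k α t = profileDeriv k α t ^ 2 / (16 * profile k α t) := by
  have h1 := profile_pos (matchTime_bounds hk hα ht).1
  have h2 := (lapseSq_pos hk hα ht).ne'
  have h3 : radialSq k α c t * lapseSq k α t = c ^ 2 - lapseSq k α t := by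
    rw [radialSq]
    field_simp
  rw [h3, hc, lapseSq, ← profileDeriv_sq k α t]
  field_simp
  ring

theorem radialSq_pos (hc : c ^ 2 = 1 - (k : ℝ) / 4) (ht : t ∈ matchTime α) :
    0 < radialSq k α c t := by
  have h1 := profile_pos (matchTime_bounds hk hα ht).1
  have h2 := (matchTime_bounds hk hα ht).2.2
  have h3 : 0 < radialSq k α c t * lapseSq k α t := by
    rw [radialSq_mul_lapseSq hk hα hc ht]
    positivity
  exact (mul_pos_iff_of_pos_right (lapseSq_pos hk hα ht)).1 h3

theorem hasDerivAt_lapseSq (ht : t ∈ matchTime α) :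
    HasDerivAt (lapseSq k α) (lapseSqDeriv k α t) t := by
  have h1 := (profile_pos (matchTime_bounds hk hα ht).1).ne'
  refine (((hasDerivAt_const t (α ^ 2 / 16)).fun_div (hasDerivAt_profile k α t) h1).const_sub
    1).congr_deriv ?_
  rw [lapseSqDeriv]
  ring

theorem hasDerivAt_div_lapseSq (b : ℝ) (ht : t ∈ matchTime α) :
    HasDerivAt (fun t => b / lapseSq k α t) (-(b * lapseSqDeriv k α t / lapseSq k α t ^ 2)) t := by
  refine ((hasDerivAt_const t b).fun_div (hasDerivAt_lapseSq hk hα ht)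
    (lapseSq_pos hk hα ht).ne').congr_deriv ?_
  ring

theorem hasDerivAt_radialSq (ht : t ∈ matchTime α) :
    HasDerivAt (radialSq k α c) (-(c ^ 2 * lapseSqDeriv k α t / lapseSq k α t ^ 2)) t :=
  (hasDerivAt_div_lapseSq hk hα (c ^ 2) ht).sub_const 1

theorem contDiffOn_lapseSq {n : WithTop ℕ∞} : ContDiffOn ℝ n (lapseSq k α) (matchTime α) :=
  contDiffOn_const.sub (contDiffOn_const.div (contDiff_profile k α).contDiffOn
    fun _ ht => (profile_pos (matchTime_bounds hk hα ht).1).ne')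

theorem contDiffOn_div_lapseSq (b : ℝ) {n : WithTop ℕ∞} :
    ContDiffOn ℝ n (fun t => b / lapseSq k α t) (matchTime α) :=
  contDiffOn_const.div (contDiffOn_lapseSq hk hα) fun _ ht => (lapseSq_pos hk hα ht).ne'

theorem contDiffOn_radialSq {n : WithTop ℕ∞} :
    ContDiffOn ℝ n (radialSq k α c) (matchTime α) :=
  (contDiffOn_div_lapseSq hk hα (c ^ 2)).sub contDiffOn_const

/-- The static time along the hypersurface. -/
theorem exists_staticTime (c : ℝ) : ∃ T : ℝ → ℝ, ContDiffOn ℝ 3 T (matchTime α) ∧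
    ∀ t ∈ matchTime α, HasDerivAt T (c / lapseSq k α t) t := by
  have hcont : ContinuousOn (fun t => c / lapseSq k α t) (matchTime α) :=
    (contDiffOn_div_lapseSq hk hα c (n := 0)).continuousOn
  have hmid : 3 * α / 16 ∈ matchTime α := ⟨by linarith, by linarith⟩
  have hder : ∀ t ∈ matchTime α,
      HasDerivAt (fun t => ∫ s in (3 * α / 16)..t, c / lapseSq k α s) (c / lapseSq k α t) t := by
    intro t ht
    refine intervalIntegral.integral_hasDerivAt_right ?_ ?_ ?_
    · exact (hcont.mono (Set.ordConnected_Ioo.uIcc_subset hmid ht)).intervalIntegrable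
    · exact hcont.stronglyMeasurableAtFilter isOpen_Ioo t ht
    · exact hcont.continuousAt (isOpen_Ioo.mem_nhds ht)
  refine ⟨_, ?_, hder⟩
  have h3 : (3 : WithTop ℕ∞) = 2 + 1 := by norm_num
  rw [h3, contDiffOn_succ_iff_deriv_of_isOpen (isOpen_matchTime α)]
  refine ⟨fun t ht => (hder t ht).differentiableAt.differentiableWithinAt, by simp, ?_⟩
  exact (contDiffOn_div_lapseSq hk hα c).congr fun t ht => (hder t ht).deriv

end StaticExterior

/-- The static exterior, with `A² = lapseSq`, `B² = radialSq`, `C² = (α ρ - k ρ²) / 4`, `D = 1`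
and `E = 0`. -/
noncomputable def staticExterior (k : ℤ) (hk : k = 1 ∨ k = 0 ∨ k = -1) (α : ℝ) (hα : 0 < α)
    (c : ℝ) (hc : c ^ 2 = 1 - (k : ℝ) / 4) : StaticCylindrical where
  K := matchTime α
  isOpen_K := isOpen_Ioo
  isConnected_K := isConnected_Ioo (by linarith)
  A := fun t => √(lapseSq k α t)
  B := fun t => √(radialSq k α c t)
  C := fun t => √(profile k α t) / 2
  D := fun _ => 1
  E := fun _ => 0
  contDiffOn_A := (contDiffOn_lapseSq hk hα).sqrt fun _ ht => (lapseSq_pos hk hα ht).ne'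
  contDiffOn_B := (contDiffOn_radialSq hk hα).sqrt fun _ ht => (radialSq_pos hk hα hc ht).ne'
  contDiffOn_C := ((contDiff_profile k α).contDiffOn.sqrt
    fun _ ht => (profile_pos (matchTime_bounds hk hα ht).1).ne').div_const 2
  contDiffOn_D := contDiffOn_const
  contDiffOn_E := contDiffOn_const
  A_pos := fun _ ht => Real.sqrt_pos.2 (lapseSq_pos hk hα ht)
  B_pos := fun _ ht => Real.sqrt_pos.2 (radialSq_pos hk hα hc ht)
  C_pos := fun _ ht => half_pos (Real.sqrt_pos.2 (profile_pos (matchTime_bounds hk hα ht).1))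
  orbits_spacelike := fun t ht => by
    have := Real.sqrt_pos.2 (profile_pos (matchTime_bounds hk hα ht).1)
    have : 0 < (√(profile k α t) / 2) ^ 2 := by positivity
    linarith

theorem staticExterior_metric {k : ℤ} {hk : k = 1 ∨ k = 0 ∨ k = -1} {α : ℝ} {hα : 0 < α}
    {c : ℝ} {hc : c ^ 2 = 1 - (k : ℝ) / 4} {x : Fin 4 → ℝ} (hx : x 1 ∈ matchTime α) :
    (staticExterior k hk α hα c hc).metric x =
      !![-lapseSq k α (x 1), 0, 0, 0;
         0, radialSq k α c (x 1), 0, 0;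
         0, 0, profile k α (x 1) / 4, 0;
         0, 0, 0, 1] := by
  have h1 := Real.sq_sqrt (lapseSq_pos hk hα hx).le
  have h2 := Real.sq_sqrt (radialSq_pos hk hα hc hx).le
  have h3 := Real.sq_sqrt (profile_pos (matchTime_bounds hk hα hx).1).le
  simp only [StaticCylindrical.metric, staticExterior, div_pow, h1, h2, h3]
  norm_num

theorem partialD_staticExterior_metric {k : ℤ} {hk : k = 1 ∨ k = 0 ∨ k = -1} {α : ℝ} {hα : 0 < α}
    {c : ℝ} {hc : c ^ 2 = 1 - (k : ℝ) / 4} {x : Fin 4 → ℝ} (hx : x 1 ∈ matchTime α)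
    (κ μ ν : Fin 4) :
    partialD κ (fun y => (staticExterior k hk α hα c hc).metric y μ ν) x =
      if κ = 1 then
        !![-lapseSqDeriv k α (x 1), 0, 0, 0;
           0, -(c ^ 2 * lapseSqDeriv k α (x 1) / lapseSq k α (x 1) ^ 2), 0, 0;
           0, 0, profileDeriv k α (x 1) / 4, 0;
           0, 0, 0, 0] μ ν
      else 0 := by
  have hev : (fun y => (staticExterior k hk α hα c hc).metric y μ ν) =ᶠ[nhds x] fun y =>
      !![-lapseSq k α (y 1), 0, 0, 0;
         0, radialSq k α c (y 1), 0, 0;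
         0, 0, profile k α (y 1) / 4, 0;
         0, 0, 0, 1] μ ν := by
    filter_upwards [((isOpen_matchTime α).preimage (continuous_apply 1)).mem_nhds
      (show x ∈ (fun y : Fin 4 → ℝ => y 1) ⁻¹' matchTime α from hx)] with y hy
    rw [staticExterior_metric hy]
  rw [partialD_congr hev]
  split_ifs with h
  · subst h
    have e1 := (hasDerivAt_lapseSq hk hα hx).deriv
    have e2 := (hasDerivAt_radialSq hk hα (c := c) hx).deriv
    have e3 := (hasDerivAt_profile k α (x 1)).deriv
    fin_cases μ <;> fin_cases ν <;> simp [partialD, e1, e2, e3]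
  · simp [partialD, Function.update_of_ne (Ne.symm h)]

/-! ### The matching hypersurface -/

/-- The hypersurface `r = r₀` of the stiff fluid, in the coordinates `(t, φ, z)`. -/
noncomputable def fluidEmbedding (r₀ : ℝ) (ξ : Fin 3 → ℝ) : Fin 4 → ℝ := ![ξ 0, r₀, ξ 1, ξ 2]

/-- Its image in the static exterior: `T = T(t)`, `ρ = t`. -/
noncomputable def staticEmbedding (T : ℝ → ℝ) (ξ : Fin 3 → ℝ) : Fin 4 → ℝ :=
  ![T (ξ 0), ξ 0, ξ 1, ξ 2]

theorem tangentVec_fluidEmbedding (r₀ : ℝ) (a : Fin 3) (ξ : Fin 3 → ℝ) :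
    tangentVec (fluidEmbedding r₀) a ξ =
      (![![1, 0, 0, 0], ![0, 0, 1, 0], ![0, 0, 0, 1]] : Fin 3 → Fin 4 → ℝ) a := by
  funext μ
  fin_cases a <;> fin_cases μ <;> simp [tangentVec, fluidEmbedding, partialD]

theorem tangentVec_staticEmbedding {T : ℝ → ℝ} {ξ : Fin 3 → ℝ} {T' : ℝ}
    (hT : HasDerivAt T T' (ξ 0)) (a : Fin 3) :
    tangentVec (staticEmbedding T) a ξ =
      (![![T', 1, 0, 0], ![0, 0, 1, 0], ![0, 0, 0, 1]] : Fin 3 → Fin 4 → ℝ) a := by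
  funext μ
  fin_cases a <;> fin_cases μ <;> simp [tangentVec, staticEmbedding, partialD, hT.deriv]

/-- The second fundamental form without the inverse metric. -/
theorem secondForm_eq {g : MetricField} {Φ l : (Fin 3 → ℝ) → (Fin 4 → ℝ)} {ξ : Fin 3 → ℝ}
    (hdet : IsUnit (g (Φ ξ)).det) (a b : Fin 3) :
    secondForm g Φ l a b ξ =
      -(metricAt g (Φ ξ) (l ξ) (fun ν => partialD a (fun η => tangentVec Φ b η ν) ξ) +
        (1 / 2) * ∑ i, l ξ i * ∑ μ, ∑ κ, (partialD μ (fun y => g y i κ) (Φ ξ)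
        + partialD κ (fun y => g y i μ) (Φ ξ) - partialD i (fun y => g y μ κ) (Φ ξ)) *
          tangentVec Φ a ξ μ * tangentVec Φ b ξ κ) := by
  rw [← metricAt_christoffel hdet, ← metricAt_add_right]
  rfl

theorem linearIndependent_tangent (p q : ℝ) (h : p ≠ 0 ∨ q ≠ 0) :
    LinearIndependent ℝ
      (![![p, q, 0, 0], ![0, 0, 1, 0], ![0, 0, 0, 1]] : Fin 3 → Fin 4 → ℝ) := by
  rw [Fintype.linearIndependent_iff]
  intro g hg
  have h0 := congrFun hg 0
  have h1 := congrFun hg 1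
  have h2 := congrFun hg 2
  have h3 := congrFun hg 3
  simp [Fin.sum_univ_three] at h0 h1 h2 h3
  have h4 : g 0 = 0 := by
    rcases h with h | h
    · simpa [h] using h0
    · simpa [h] using h1
  intro i
  fin_cases i <;> simp [h2, h3, h4]

theorem notMem_span_tangent {p q l₀ l₁ : ℝ} (h : l₀ * q ≠ l₁ * p) :
    (![l₀, l₁, 0, 0] : Fin 4 → ℝ) ∉ Submodule.span ℝ (Set.range
      (![![p, q, 0, 0], ![0, 0, 1, 0], ![0, 0, 0, 1]] : Fin 3 → Fin 4 → ℝ)) := by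
  intro hmem
  obtain ⟨c, hc⟩ := (Submodule.mem_span_range_iff_exists_fun ℝ).1 hmem
  have h0 := congrFun hc 0
  have h1 := congrFun hc 1
  simp [Fin.sum_univ_three] at h0 h1
  apply h
  rw [← h0, ← h1]
  ring

theorem exists_sigmaFn_eq_half {k : ℤ} (hk : k = 1 ∨ k = 0 ∨ k = -1) :
    ∃ r, 0 < r ∧ (k = 1 → r < Real.pi) ∧ sigmaFn k r = 1 / 2 := by
  rcases hk with rfl | rfl | rfl
  · exact ⟨Real.pi / 6, by positivity, fun _ => by linarith [Real.pi_pos], by simp [sigmaFn]⟩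
  · exact ⟨1 / 2, by norm_num, by norm_num, by simp [sigmaFn]⟩
  · exact ⟨Real.arsinh (1 / 2), Real.arsinh_pos_iff.2 (by norm_num), by norm_num,
      by simp [sigmaFn]⟩

section Matching

variable {k : ℤ} {hk : k = 1 ∨ k = 0 ∨ k = -1} {α : ℝ} {hα : 0 < α} {r₀ : ℝ}

theorem metricAt_stiffLRS {x v w : Fin 4 → ℝ} (hx : x 0 ∈ stiffTime k α) :
    metricAt (stiffLRS k hk α hα).metric x v w = -(v 0 * w 0) + profile k α (x 0) * (v 1 * w 1)
      + profile k α (x 0) * sigmaFn k (x 1) ^ 2 * (v 2 * w 2) + v 3 * w 3 := by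
  simp only [metricAt, stiffLRS_metric hx, warpedMetric, Fin.sum_univ_four]
  simp
  ring

theorem metricAt_staticExterior {c : ℝ} {hc : c ^ 2 = 1 - (k : ℝ) / 4} {x v w : Fin 4 → ℝ}
    (hx : x 1 ∈ matchTime α) :
    metricAt (staticExterior k hk α hα c hc).metric x v w =
      -(lapseSq k α (x 1) * (v 0 * w 0)) + radialSq k α c (x 1) * (v 1 * w 1)
      + profile k α (x 1) / 4 * (v 2 * w 2) + v 3 * w 3 := by
  simp only [metricAt, staticExterior_metric hx, Fin.sum_univ_four]
  simp
  ring

theorem secondForm_fluid {ξ : Fin 3 → ℝ} (hξ : ξ 0 ∈ matchTime α) (h0 : 0 < r₀)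
    (h1 : k = 1 → r₀ < Real.pi) (a b : Fin 3) :
    secondForm (stiffLRS k hk α hα).metric (fluidEmbedding r₀)
      (fun ξ => ![0, 1 / profile k α (ξ 0), 0, 0]) a b ξ =
      !![0, 0, 0; 0, sigmaFn k r₀ * sigmaDeriv k r₀, 0; 0, 0, 0] a b := by
  have ht := (matchTime_bounds hk hα hξ).1
  have hx : fluidEmbedding r₀ ξ 0 ∈ stiffTime k α := by simpa [fluidEmbedding] using ht
  have hxd : fluidEmbedding r₀ ξ ∈ (stiffLRS k hk α hα).domain := by
    refine ⟨hx, ?_, ?_⟩ <;> simpa [fluidEmbedding, stiffLRS]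
  have hW := (profile_pos ht).ne'
  rw [secondForm_eq (LRSSpacetime.isUnit_det_metric hxd)]
  have hpd : ∀ κ μ ν, partialD κ (fun y => (stiffLRS k hk α hα).metric y μ ν)
      (fluidEmbedding r₀ ξ) = partialD κ (fun y => warpedMetric 0 1 (profile k α) (sigmaFn k) y μ ν)
      (fluidEmbedding r₀ ξ) := fun κ μ ν => partialD_congr
    ((stiffLRS_metric_eventuallyEq (hk := hk) (hα := hα) hx).mono fun y hy => by simp only [hy]) κ
  simp only [hpd, partialD_warpedMetric (hasDerivAt_profile k α _) (hasDerivAt_sigmaFn k _),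
    tangentVec_fluidEmbedding, metricAt_stiffLRS hx, Fin.sum_univ_four]
  fin_cases a <;> fin_cases b <;> simp [partialD, fluidEmbedding]
  field_simp

theorem secondForm_static {c : ℝ} {hc : c ^ 2 = 1 - (k : ℝ) / 4} {T : ℝ → ℝ}
    (hT : ∀ t ∈ matchTime α, HasDerivAt T (c / lapseSq k α t) t)
    {ξ : Fin 3 → ℝ} (hξ : ξ 0 ∈ matchTime α) (a b : Fin 3) :
    secondForm (staticExterior k hk α hα c hc).metric (staticEmbedding T)
      (fun ξ => ![4 * radialSq k α c (ξ 0) / profileDeriv k α (ξ 0),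
        4 * c / profileDeriv k α (ξ 0), 0, 0]) a b ξ =
      !![0, 0, 0; 0, c / 2, 0; 0, 0, 0] a b := by
  have hx : staticEmbedding T ξ 1 ∈ matchTime α := by simpa [staticEmbedding] using hξ
  have hW' := (matchTime_bounds hk hα hξ).2.2.ne'
  have hL := (lapseSq_pos hk hα hξ).ne'
  rw [secondForm_eq (StaticCylindrical.isUnit_det_metric hx)]
  have hdt : ∀ ν, partialD a (fun η => tangentVec (staticEmbedding T) b η ν) ξ =
      if a = 0 ∧ b = 0 ∧ ν = 0 then -(c * lapseSqDeriv k α (ξ 0) / lapseSq k α (ξ 0) ^ 2)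
      else 0 := by
    intro ν
    have hev : (fun η => tangentVec (staticEmbedding T) b η ν) =ᶠ[nhds ξ] fun η =>
        (![![c / lapseSq k α (η 0), 1, 0, 0], ![0, 0, 1, 0], ![0, 0, 0, 1]] :
          Fin 3 → Fin 4 → ℝ) b ν := by
      filter_upwards [((isOpen_matchTime α).preimage (continuous_apply 0)).mem_nhds
        (show ξ ∈ (fun y : Fin 3 → ℝ => y 0) ⁻¹' matchTime α from hξ)] with η hη
      rw [tangentVec_staticEmbedding (hT _ hη)]
    have hd := (hasDerivAt_div_lapseSq hk hα c hξ).deriv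
    rw [partialD_congr hev]
    fin_cases a <;> fin_cases b <;> fin_cases ν <;> simp [partialD, hd]
  simp only [hdt, partialD_staticExterior_metric hx, tangentVec_staticEmbedding (hT _ hξ),
    metricAt_staticExterior hx, Fin.sum_univ_four]
  fin_cases a <;> fin_cases b <;> simp [staticEmbedding]
  · rw [radialSq]
    field_simp
    ring
  · field_simp

/-- The matching of the stiff fluid to its static exterior across `r = r₀`, `Σ(r₀,k) = 1 / 2`,
with riggings normal to the hypersurface. -/
noncomputable def stiffMatching {c : ℝ} {hc : c ^ 2 = 1 - (k : ℝ) / 4} (h0 : 0 < r₀)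
    (h1 : k = 1 → r₀ < Real.pi) (hr : sigmaFn k r₀ = 1 / 2) (hcr : sigmaDeriv k r₀ = c)
    {T : ℝ → ℝ} (hT3 : ContDiffOn ℝ 3 T (matchTime α))
    (hT : ∀ t ∈ matchTime α, HasDerivAt T (c / lapseSq k α t) t) :
    Matching (stiffLRS k hk α hα).metric (stiffLRS k hk α hα).domain
      (staticExterior k hk α hα c hc).metric (staticExterior k hk α hα c hc).domain where
  S := {ξ | ξ 0 ∈ matchTime α}
  isOpen_S := (isOpen_matchTime α).preimage (continuous_apply 0)
  isConnected_S := by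
    refine ⟨⟨fun _ => 3 * α / 16, by constructor <;> linarith⟩, Convex.isPreconnected ?_⟩
    exact (convex_Ioo (α / 8) (α / 4)).is_linear_preimage
      (f := fun ξ : Fin 3 → ℝ => ξ 0) ⟨fun _ _ => rfl, fun _ _ => rfl⟩
  Φp := fluidEmbedding r₀
  Φm := staticEmbedding T
  mapsTo_p := fun ξ hξ => by
    refine ⟨?_, ?_, ?_⟩
    · simpa [fluidEmbedding, stiffLRS] using (matchTime_bounds hk hα hξ).1
    · simpa [fluidEmbedding]
    · simpa [fluidEmbedding, stiffLRS]
  mapsTo_m := fun ξ hξ => by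
    simpa [staticEmbedding, StaticCylindrical.domain, staticExterior] using hξ
  contDiffOn_p := by
    refine ContDiff.contDiffOn (contDiff_pi.2 fun i => ?_)
    fin_cases i <;> simp [fluidEmbedding] <;> fun_prop
  contDiffOn_m := by
    refine contDiffOn_pi.2 fun i => ?_
    have hid : ∀ j : Fin 3, ContDiffOn ℝ 3 (fun ξ : Fin 3 → ℝ => ξ j) {ξ | ξ 0 ∈ matchTime α} :=
      fun j => (contDiff_apply ℝ ℝ j).contDiffOn
    fin_cases i
    · exact hT3.comp (hid 0) fun ξ hξ => hξ
    · exact hid 0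
    · exact hid 1
    · exact hid 2
  isEmbedding_p := by
    refine Topology.IsEmbedding.of_comp (g := fun x : Fin 4 → ℝ => (![x 0, x 2, x 3] : Fin 3 → ℝ))
      ?_ ?_ ?_
    · have hj : ∀ j : Fin 3, Continuous fun ξ : {ξ : Fin 3 → ℝ | ξ 0 ∈ matchTime α} =>
          (ξ : Fin 3 → ℝ) j := fun j => (continuous_apply j).comp continuous_subtype_val
      refine continuous_pi fun i => ?_
      fin_cases i
      · exact hj 0
      · exact continuous_const
      · exact hj 1
      · exact hj 2
    · refine continuous_pi fun i => ?_
      fin_cases i <;> simp <;> fun_prop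
    · convert Topology.IsEmbedding.subtypeVal using 1
      funext ξ i
      fin_cases i <;> simp [fluidEmbedding, Set.domRestrict]
  isEmbedding_m := by
    refine Topology.IsEmbedding.of_comp (g := fun x : Fin 4 → ℝ => (![x 1, x 2, x 3] : Fin 3 → ℝ))
      ?_ ?_ ?_
    · have hj : ∀ j : Fin 3, Continuous fun ξ : {ξ : Fin 3 → ℝ | ξ 0 ∈ matchTime α} =>
          (ξ : Fin 3 → ℝ) j := fun j => (continuous_apply j).comp continuous_subtype_val
      refine continuous_pi fun i => ?_
      fin_cases i
      · exact hT3.continuousOn.comp_continuous (hj 0) fun ξ => ξ.2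
      · exact hj 0
      · exact hj 1
      · exact hj 2
    · refine continuous_pi fun i => ?_
      fin_cases i <;> simp <;> fun_prop
    · convert Topology.IsEmbedding.subtypeVal using 1
      funext ξ i
      fin_cases i <;> simp [staticEmbedding, Set.domRestrict]
  rank_p := fun ξ _ => by
    simp only [tangentVec_fluidEmbedding]
    exact linearIndependent_tangent 1 0 (Or.inl one_ne_zero)
  rank_m := fun ξ hξ => by
    simp only [tangentVec_staticEmbedding (hT _ hξ)]
    exact linearIndependent_tangent _ 1 (Or.inr one_ne_zero)
  first_form := fun ξ hξ a b => by
    have hx : fluidEmbedding r₀ ξ 0 ∈ stiffTime k α := by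
      simpa [fluidEmbedding] using (matchTime_bounds hk hα hξ).1
    have hy : staticEmbedding T ξ 1 ∈ matchTime α := by simpa [staticEmbedding] using hξ
    have hL := (lapseSq_pos hk hα hξ).ne'
    simp only [tangentVec_staticEmbedding (hT _ hξ), tangentVec_fluidEmbedding,
      metricAt_stiffLRS hx, metricAt_staticExterior hy]
    fin_cases a <;> fin_cases b <;> simp [fluidEmbedding, staticEmbedding, hr]
    · rw [radialSq]
      field_simp
      ring
    · ring
  lp := fun ξ => ![0, 1 / profile k α (ξ 0), 0, 0]
  lm := fun ξ => ![4 * radialSq k α c (ξ 0) / profileDeriv k α (ξ 0),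
        4 * c / profileDeriv k α (ξ 0), 0, 0]
  continuousOn_lp := by
    have h : ContinuousOn (fun t => 1 / profile k α t) (matchTime α) :=
      continuousOn_const.div (contDiff_profile k α (n := 0)).continuous.continuousOn
        fun t ht => (profile_pos (matchTime_bounds hk hα ht).1).ne'
    refine continuousOn_pi.2 fun i => ?_
    fin_cases i
    · exact continuousOn_const
    · exact h.comp (continuous_apply 0).continuousOn fun ξ hξ => hξ
    · exact continuousOn_const
    · exact continuousOn_const
  continuousOn_lm := by
    have hd : ContinuousOn (profileDeriv k α) (matchTime α) := fun t _ =>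
      (hasDerivAt_profileDeriv k α t).continuousAt.continuousWithinAt
    have hn : ∀ t ∈ matchTime α, profileDeriv k α t ≠ 0 := fun t ht =>
      (matchTime_bounds hk hα ht).2.2.ne'
    have h1 : ContinuousOn (fun t => 4 * radialSq k α c t / profileDeriv k α t) (matchTime α) :=
      (continuousOn_const.mul (contDiffOn_radialSq hk hα (n := 0)).continuousOn).div hd hn
    have h2 : ContinuousOn (fun t => 4 * c / profileDeriv k α t) (matchTime α) :=
      continuousOn_const.div hd hn
    refine continuousOn_pi.2 fun i => ?_
    fin_cases i
    · exact h1.comp (continuous_apply 0).continuousOn fun ξ hξ => hξ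
    · exact h2.comp (continuous_apply 0).continuousOn fun ξ hξ => hξ
    · exact continuousOn_const
    · exact continuousOn_const
  transversal_p := fun ξ hξ => by
    simp only [tangentVec_fluidEmbedding]
    refine notMem_span_tangent ?_
    have := (profile_pos (matchTime_bounds hk hα hξ).1).ne'
    simpa using this.symm
  transversal_m := fun ξ hξ => by
    simp only [tangentVec_staticEmbedding (hT _ hξ)]
    refine notMem_span_tangent fun h => ?_
    have hL := (lapseSq_pos hk hα hξ).ne'
    have hW' := (matchTime_bounds hk hα hξ).2.2.ne'
    rw [radialSq] at h
    field_simp at h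
    apply hL
    linarith
  rigging_norm := fun ξ hξ => by
    have ht := (matchTime_bounds hk hα hξ).1
    have hx : fluidEmbedding r₀ ξ 0 ∈ stiffTime k α := by simpa [fluidEmbedding] using ht
    have hy : staticEmbedding T ξ 1 ∈ matchTime α := by simpa [staticEmbedding] using hξ
    have hL := (lapseSq_pos hk hα hξ).ne'
    have hW := (profile_pos ht).ne'
    have hW' := (matchTime_bounds hk hα hξ).2.2.ne'
    have hBA := radialSq_mul_lapseSq hk hα hc hξ
    have hB : c ^ 2 - radialSq k α c (ξ 0) * lapseSq k α (ξ 0) = lapseSq k α (ξ 0) := by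
      rw [radialSq]
      field_simp
      ring
    rw [metricAt_stiffLRS hx, metricAt_staticExterior hy]
    simp only [fluidEmbedding, staticEmbedding, Matrix.cons_val_zero, Matrix.cons_val_one,
      Matrix.cons_val, mul_zero, add_zero, neg_zero, zero_add]
    -- the norm on the static side is `16 B² (c² - A² B²) / W'² = 16 A² B² / W'² = 1 / W`
    calc profile k α (ξ 0) * (1 / profile k α (ξ 0) * (1 / profile k α (ξ 0)))
        = 16 / profileDeriv k α (ξ 0) ^ 2 *
            (profileDeriv k α (ξ 0) ^ 2 / (16 * profile k α (ξ 0))) := by field_simp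
      _ = 16 / profileDeriv k α (ξ 0) ^ 2 * (radialSq k α c (ξ 0) *
            (c ^ 2 - radialSq k α c (ξ 0) * lapseSq k α (ξ 0))) := by rw [hB, hBA]
      _ = _ := by ring
  rigging_tangent := fun ξ hξ a => by
    have hx : fluidEmbedding r₀ ξ 0 ∈ stiffTime k α := by
      simpa [fluidEmbedding] using (matchTime_bounds hk hα hξ).1
    have hy : staticEmbedding T ξ 1 ∈ matchTime α := by simpa [staticEmbedding] using hξ
    have hL := (lapseSq_pos hk hα hξ).ne'
    simp only [tangentVec_staticEmbedding (hT _ hξ), tangentVec_fluidEmbedding,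
      metricAt_stiffLRS hx, metricAt_staticExterior hy]
    fin_cases a <;> simp [staticEmbedding]
    field_simp
    ring
  second_form := fun ξ hξ a b => by
    rw [secondForm_fluid hξ h0 h1, secondForm_static hT hξ, hr, hcr, one_div_mul_eq_div]

theorem exists_stiffMatching (k : ℤ) (hk : k = 1 ∨ k = 0 ∨ k = -1) (α : ℝ) (hα : 0 < α) :
    ∃ (N : StaticCylindrical) (σ : Matching (stiffLRS k hk α hα).metric
        (stiffLRS k hk α hα).domain N.metric N.domain),
      σ.NonSpacelike ∧ PreservesCylindricalSymmetry (stiffLRS k hk α hα) N σ ∧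
        (stiffLRS k hk α hα).NonStaticOn σ.timeRange := by
  obtain ⟨r₀, h0, h1, hr⟩ := exists_sigmaFn_eq_half hk
  have hc : sigmaDeriv k r₀ ^ 2 = 1 - (k : ℝ) / 4 := by
    have := sigmaDeriv_sq_add hk r₀
    rw [hr] at this
    linarith
  obtain ⟨T, hT3, hT⟩ := exists_staticTime hk hα (sigmaDeriv k r₀)
  refine ⟨staticExterior k hk α hα _ hc, stiffMatching h0 h1 hr rfl hT3 hT, ?_, ?_, ?_⟩
  · intro ξ hξ
    have hx : fluidEmbedding r₀ ξ 0 ∈ stiffTime k α := by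
      simpa [fluidEmbedding] using (matchTime_bounds hk hα hξ).1
    refine ⟨_, Submodule.subset_span ⟨0, rfl⟩, ?_, ?_⟩
    · simp [stiffMatching, tangentVec_fluidEmbedding]
    · simp [stiffMatching, tangentVec_fluidEmbedding, metricAt_stiffLRS hx]
  · refine ⟨fun _ => Pi.single 1 1, fun _ => Pi.single 2 1, contDiffOn_const, contDiffOn_const,
      0, 1, 0, fun ξ hξ => ?_⟩
    refine ⟨?_, ?_, ?_, ?_⟩ <;> funext μ <;> fin_cases μ <;>
      simp [pushForward, stiffMatching, tangentVec_fluidEmbedding,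
        tangentVec_staticEmbedding (hT _ hξ), Fin.sum_univ_three, Pi.single_apply]
  · have hmid : 3 * α / 16 ∈ matchTime α := ⟨by linarith, by linarith⟩
    obtain ⟨ht, -, hW'⟩ := matchTime_bounds hk hα hmid
    refine ⟨3 * α / 16, ⟨fun _ => 3 * α / 16, hmid, by simp [stiffMatching, fluidEmbedding]⟩,
      Or.inr ?_⟩
    have hd : deriv (stiffLRS k hk α hα).b (3 * α / 16) = _ :=
      ((hasDerivAt_profile k α (3 * α / 16)).sqrt (profile_pos ht).ne').deriv
    rw [hd]
    have := Real.sqrt_pos.2 (profile_pos ht)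
    positivity

end Matching

theorem mainTheorem2 :
    (∀ (M : LRSSpacetime) (N : StaticCylindrical)
        (σ : Matching M.metric M.domain N.metric N.domain)
        (ρ p : (Fin 4 → ℝ) → ℝ) (u : (Fin 4 → ℝ) → (Fin 4 → ℝ)),
        σ.NonSpacelike →
        PreservesCylindricalSymmetry M N σ →
        M.NonStaticOn σ.timeRange →
        (∀ x ∈ M.domain, IsPerfectFluidAt M.metric x (ρ x) (p x) (u x)) →
        (∀ x ∈ M.domain, DominantEnergy (ρ x) (p x)) →
        ∃ α β t₀ τ : ℝ, 0 < α ∧ 0 < β ∧ (τ = 1 ∨ τ = -1) ∧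
          ∀ x ∈ M.domain, x 0 ∈ σ.timeRange →
            τ * (x 0 - t₀) ∈ stiffTime M.k α ∧
            M.metric x = pullbackMetric (normalizeCoord τ t₀ β) (stiffMetric M.k α) x ∧
            ρ x = p x ∧
            ρ x = stiffDensity M.k α (τ * (x 0 - t₀))) ∧
    (∀ (k : ℤ), (k = 1 ∨ k = 0 ∨ k = -1) → ∀ α : ℝ, 0 < α →
      ∃ M : LRSSpacetime, M.k = k ∧ M.I = stiffTime k α ∧
        (∀ x ∈ M.domain, M.metric x = stiffMetric k α x ∧
          IsPerfectFluidAt M.metric x (stiffDensity k α (x 0)) (stiffDensity k α (x 0))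
            (Pi.single 0 1) ∧
          DominantEnergy (stiffDensity k α (x 0)) (stiffDensity k α (x 0))) ∧
        ∃ (N : StaticCylindrical) (σ : Matching M.metric M.domain N.metric N.domain),
          σ.NonSpacelike ∧ PreservesCylindricalSymmetry M N σ ∧ M.NonStaticOn σ.timeRange) := by
  refine ⟨exists_stiffMetric_of_matching, fun k hk α hα => ?_⟩
  refine ⟨stiffLRS k hk α hα, rfl, rfl, fun x hx => ⟨?_, ?_, ?_⟩, exists_stiffMatching k hk α hα⟩
  · rw [stiffLRS_metric hx.1, warpedMetric_eq_stiffMetric]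
  · exact (isPerfectFluidAt_stiff hk hα hx.1 (LRSSpacetime.sigma_pos hx)).congr
      (stiffLRS_metric_eventuallyEq hx.1)
  · exact (abs_of_pos (stiffDensity_pos hα hx.1)).le
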